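/- Let $\mathbb K$ be a field. An arrangement $(\mathcal A,V)$ is a finite set $\mathcal A$ of linear hyperplanes (subspaces of codimension one) in a finite-dimensional $\mathbb K$-vector space $V$. For $H_0\in\mathcal A$ put $\mathcal A'=\mathcal A\setminus\{H_0\}$, an arrangement in $V$, and $\mathcal A''=\{H_0\cap H\mid H\in\mathcal A'\}$, an arrangement in $H_0$. A partition of $\mathcal A$ is a set $\pi$ of non-empty pairwise disjoint blocks with union $\mathcal A$. The class of \emph{inductive factorizations} is the smallest class of pairs $(\mathcal A,\pi)$, with $\pi$ a partition of $\mathcal A$, such that (i) $(\varnothing,\varnothing)$ belongs to it for the empty arrangement in every $V$ (with its empty partition); (ii) $(\mathcal A,\pi)$ belongs to it whenever there are a block $\pi_1\in\pi$ and a hyperplane $H_0\in\pi_1$ such that the map $\mathcal A\setminus\pi_1\to\mathcal A''$, $H\mapsto H_0\cap H$, is bijective, and both $(\mathcal A',\pi')$ and $(\mathcal A'',\pi'')$ belong to it, where $\pi'$ consists of the non-empty sets $B\cap\mathcal A'$ with $B\in\pi$, and $\pi''$ consists of the sets $\{H_0\cap H\mid H\in B\}$ with $B\in\pi\setminus\{\pi_1\}$.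 $\mathcal A$ is \emph{inductively factored} if $(\mathcal A,\pi)$ belongs to this class for some $\pi$. Let $S=\mathrm{Sym}(V^*)$, and for $H\in\mathcal A$ let $\alpha_H\in V^*$ have kernel $H$. The arrangement $\mathcal A$ is \emph{free} if the $S$-module $D(\mathcal A)=\{\theta\in\mathrm{Der}_{\mathbb K}(S)\mid\theta(\alpha_H)\in\alpha_H S\text{ for all }H\in\mathcal A\}$ has a basis $\theta_1,\dots,\theta_\ell$ of homogeneous derivations, i.e. $\theta_i(V^*)\subseteq S_{d_i}$ for suitable $d_i\ge 0$; the multiset of \emph{exponents} of $\mathcal A$ is then $\exp\mathcal A=\{d_1,\dots,d_\ell\}$. \textbf{Proposition.} Let $(\mathcal A_1,V_1)$ and $(\mathcal A_2,V_2)$ be two arrangements over $\mathbb K$, and let $\mathcal A_1\times\mathcal A_2=\{H_1\oplus V_2\mid H_1\in\mathcal A_1\}\cup\{V_1\oplus H_2\mid H_2\in\mathcal A_2\}$ be their product, an arrangement in $V_1\oplus V_2$. Then $\mathcal A_1\times\mathcal A_2$ is inductively factored if and only if both $\mathcal A_1$ and $\mathcal A_2$ are inductively factored. In that case $\mathcal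 A_1$, $\mathcal A_2$ and $\mathcal A_1\times\mathcal A_2$ are free, their multisets of exponents are well defined, and $\exp(\mathcal A_1\times\mathcal A_2)$ is the multiset union (with multiplicities added) of $\exp\mathcal A_1$ and $\exp\mathcal A_2$. -/

import Mathlib

universe u v w

/-- A central hyperplane arrangement in the `K`-vector space `V`: a finite set of linear hyperplanes
(maximal proper subspaces, i.e. subspaces of codimension one) of `V`. -/
@[ext]
structure HyperplaneArrangement (K : Type u) [Field K] (V : Type v) [AddCommGroup V]
    [Module K V] where
  /-- The set of hyperplanes of the arrangement. -/
  hyperplanes : Set (Submodule K V)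
  finite : hyperplanes.Finite
  isCoatom : ∀ H ∈ hyperplanes, IsCoatom H

namespace HyperplaneArrangement

section

variable {K : Type u} [Field K] {V : Type v} [AddCommGroup V] [Module K V]
  {W : Type w} [AddCommGroup W] [Module K W]

variable (K V) in
/-- The empty arrangement in `V`. -/
def empty : HyperplaneArrangement K V where
  hyperplanes := ∅
  finite := Set.finite_empty
  isCoatom := fun _ h => h.elim

/-- The deletion `A' = A \ {H₀}`. -/
def deletion (A : HyperplaneArrangement K V) (H₀ : Submodule K V) : HyperplaneArrangement K V where
  hyperplanes := A.hyperplanes \ {H₀}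
  finite := A.finite.subset Set.sdiff_subset
  isCoatom := fun H h => A.isCoatom H h.1

/-- The intersection `X ∩ H`, as a subspace of the vector space `X`. -/
def interIn (X H : Submodule K V) : Submodule K X := H.comap X.subtype

theorem isCoatom_interIn {X H : Submodule K V} (hH : IsCoatom H) (hX : ¬ X ≤ H) :
    IsCoatom (interIn X H) := by
  rcases Submodule.isCoatom_comap_or_eq_top X.subtype hH with h | h
  · exact h
  · exact absurd (fun x hx => by
      have hm : (⟨x, hx⟩ : X) ∈ H.comap X.subtype := by rw [h]; trivial
      exact hm) hX

/-- The restriction `(A^X, X)`, where `A^X = {X ∩ H | H ∈ A, X ⊄ H}`. For `X = H₀ ∈ A` this is the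
arrangement `A''` of the triple `(A, A', A'')` associated with `H₀`. -/
def restriction (A : HyperplaneArrangement K V) (X : Submodule K V) :
    HyperplaneArrangement K X where
  hyperplanes := interIn X '' {H | H ∈ A.hyperplanes ∧ ¬ X ≤ H}
  finite := (A.finite.subset fun _ h => h.1).image _
  isCoatom := by
    rintro _ ⟨H, ⟨hH, hX⟩, rfl⟩
    exact isCoatom_interIn (A.isCoatom H hH) hX

/-- For `H₀ ∈ A`, the restriction to `H₀` is `A'' = {H₀ ∩ H | H ∈ A'}`. -/
theorem restriction_hyperplanes (A : HyperplaneArrangement K V) {H₀ : Submodule K V}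
    (h₀ : H₀ ∈ A.hyperplanes) :
    (A.restriction H₀).hyperplanes = interIn H₀ '' (A.deletion H₀).hyperplanes := by
  have : {H | H ∈ A.hyperplanes ∧ ¬ H₀ ≤ H} = A.hyperplanes \ {H₀} := by
    ext H
    refine and_congr_right fun hH => not_congr ⟨fun h => ?_, fun h => ?_⟩
    · rcases (A.isCoatom _ h₀).le_iff.1 h with h | h
      · exact absurd h (A.isCoatom _ hH).1
      · exact h
    · exact le_of_eq (Set.mem_singleton_iff.1 h).symm
  exact congrArg (fun s => interIn H₀ '' s) this

/-- The product arrangement in `V ⊕ W`, consisting of the hyperplanes `H₁ ⊕ W` for `H₁ ∈ A₁` and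
`V ⊕ H₂` for `H₂ ∈ A₂`. -/
def prod (A₁ : HyperplaneArrangement K V) (A₂ : HyperplaneArrangement K W) :
    HyperplaneArrangement K (V × W) where
  hyperplanes := (fun H₁ : Submodule K V => H₁.prod (⊤ : Submodule K W)) '' A₁.hyperplanes ∪
    (fun H₂ : Submodule K W => (⊤ : Submodule K V).prod H₂) '' A₂.hyperplanes
  finite := (A₁.finite.image _).union (A₂.finite.image _)
  isCoatom := by
    rintro _ (⟨H, hH, rfl⟩ | ⟨H, hH, rfl⟩)
    · have : H.prod (⊤ : Submodule K W) = H.comap (LinearMap.fst K V W) := by ext; simp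
      change IsCoatom (H.prod (⊤ : Submodule K W))
      rw [this, Submodule.isCoatom_comap_iff LinearMap.fst_surjective]
      exact A₁.isCoatom H hH
    · have : (⊤ : Submodule K V).prod H = H.comap (LinearMap.snd K V W) := by ext; simp
      change IsCoatom ((⊤ : Submodule K V).prod H)
      rw [this, Submodule.isCoatom_comap_iff LinearMap.snd_surjective]
      exact A₂.isCoatom H hH

/-- `π` is a partition of `A`: a set of non-empty, pairwise disjoint blocks with union `A`. The
empty arrangement has exactly one partition, the empty one. -/
structure IsPartition (A : HyperplaneArrangement K V) (π : Set (Set (Submodule K V))) : Prop where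
  nonempty : ∀ B ∈ π, B.Nonempty
  disjoint : π.PairwiseDisjoint id
  sUnion : ⋃₀ π = A.hyperplanes

/-- The induced partition `π'` of `A' = A \ {H₀}`: the non-empty sets `B ∩ A'` for `B ∈ π`. -/
def deletionPartition (A : HyperplaneArrangement K V) (π : Set (Set (Submodule K V)))
    (H₀ : Submodule K V) : Set (Set (Submodule K V)) :=
  {C | C.Nonempty ∧ ∃ B ∈ π, C = B ∩ (A.deletion H₀).hyperplanes}

/-- The induced family `π''` on `A''`, where `B₁` is the block of `π` containing `H₀`: the images
`{H₀ ∩ H | H ∈ B}` of the remaining blocks `B` of `π`. -/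
def restrictionPartition (π : Set (Set (Submodule K V))) (B₁ : Set (Submodule K V))
    (H₀ : Submodule K V) : Set (Set (Submodule K H₀)) :=
  (fun B => interIn H₀ '' B) '' (π \ {B₁})

end

/-- `IsInductiveFactorization A π` says that the pair `(A, π)` lies in the smallest class of pairs
(arrangement, partition) that contains all empty arrangements with the empty partition, and that
contains `(A, π)` whenever some hyperplane `H₀`, in the block `B₁` of `π`, is such that
`H ↦ H₀ ∩ H` is a bijection from `A \ B₁` onto `A''`, and `(A', π')` and `(A'', π'')` are in the
class. -/
inductive IsInductiveFactorization {K : Type u} [Field K] :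
    {V : Type v} → [AddCommGroup V] → [Module K V] →
      HyperplaneArrangement K V → Set (Set (Submodule K V)) → Prop
  | empty (V : Type v) [AddCommGroup V] [Module K V] :
      IsInductiveFactorization (HyperplaneArrangement.empty K V) ∅
  | addition {V : Type v} [AddCommGroup V] [Module K V] (A : HyperplaneArrangement K V)
      (π : Set (Set (Submodule K V))) (hπ : A.IsPartition π)
      (B₁ : Set (Submodule K V)) (hB₁ : B₁ ∈ π) (H₀ : Submodule K V) (hH₀ : H₀ ∈ B₁)
      (bij : Set.BijOn (interIn H₀) (A.hyperplanes \ B₁) (A.restriction H₀).hyperplanes)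
      (deletion : IsInductiveFactorization (A.deletion H₀) (A.deletionPartition π H₀))
      (restriction : IsInductiveFactorization (A.restriction H₀) (restrictionPartition π B₁ H₀)) :
      IsInductiveFactorization A π

section

variable {K : Type u} [Field K] {V : Type v} [AddCommGroup V] [Module K V]

/-- `A` is inductively factored if it has an inductive factorization. -/
def IsInductivelyFactored (A : HyperplaneArrangement K V) : Prop :=
  ∃ π : Set (Set (Submodule K V)), IsInductiveFactorization A π

/-- The module of `A`-derivations: the `K`-derivations `θ` of `S = Sym(V*)` such that
`θ(α_H) ∈ α_H S` for every `H ∈ A`, where `α_H ∈ V*` is a linear form with kernel `H` (unique up to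
a non-zero scalar, on which the condition does not depend). -/
def derivationModule (A : HyperplaneArrangement K V) :
    Submodule (SymmetricAlgebra K (Module.Dual K V))
      (Derivation K (SymmetricAlgebra K (Module.Dual K V))
        (SymmetricAlgebra K (Module.Dual K V))) where
  carrier := {θ | ∀ H ∈ A.hyperplanes, ∀ α : Module.Dual K V, LinearMap.ker α = H →
    SymmetricAlgebra.ι K (Module.Dual K V) α ∣ θ (SymmetricAlgebra.ι K (Module.Dual K V) α)}
  add_mem' := fun hθ hη H hH α hα => dvd_add (hθ H hH α hα) (hη H hH α hα)
  zero_mem' := fun _ _ _ _ => dvd_zero _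
  smul_mem' := fun f _ hθ H hH α hα => Dvd.dvd.mul_left (hθ H hH α hα) f

/-- `θ` is homogeneous of polynomial degree `d`: it maps each linear form into the degree `d` part
`S_d` of `S = Sym(V*)`, which is the `K`-span of the `d`-fold products of linear forms. -/
def IsHomogeneousDerivation
    (θ : Derivation K (SymmetricAlgebra K (Module.Dual K V))
      (SymmetricAlgebra K (Module.Dual K V))) (d : ℕ) : Prop :=
  ∀ α : Module.Dual K V, θ (SymmetricAlgebra.ι K (Module.Dual K V) α) ∈
    LinearMap.range (SymmetricAlgebra.ι K (Module.Dual K V)) ^ d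

/-- `A` is free with multiset of exponents `E`: the module of `A`-derivations has a basis over `S`
of homogeneous derivations, whose polynomial degrees form the multiset `E`. -/
def IsFreeWithExponents (A : HyperplaneArrangement K V) (E : Multiset ℕ) : Prop :=
  ∃ (n : ℕ) (b : Module.Basis (Fin n) (SymmetricAlgebra K (Module.Dual K V)) A.derivationModule)
    (d : Fin n → ℕ),
    (∀ i, IsHomogeneousDerivation (b i).1 (d i)) ∧ E = Finset.univ.val.map d

end

end HyperplaneArrangement

/-!
The hyperplanes of `A₁ × A₂` are the preimages of those of `A₁` and `A₂` under the two projections.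
Restricting to `H₁ ⊕ V₂` replaces `V₁` by `H₁` and the projections by their restrictions, which are
still jointly surjective. For pullbacks along a jointly surjective pair of maps, deletion and
restriction at a hyperplane coming from one factor therefore act on that factor alone, so inductive
factorizations of the pullback induce factorizations of both factors, and conversely two
factorizations combine by induction on one and then on the other.

The exponents come from Terao's addition theorem. In an inductive factorization, the restrictions
to `H₀` of the forms `α_H` with `H ≠ H₀` in the block `B₁` of `H₀` have a product of degree
`|B₁| - 1` which divides the restriction of `θ(α_{H₀})` for every `θ ∈ D(A')`. This forces the one
basis element that distinguishes `exp A'` from `exp A''` to have degree `|B₁| - 1`, and multiplying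
it by `α_{H₀}` gives a basis of `D(A)`. Hence the non-zero exponents of `A` are the sizes of the
blocks, and exponents of products are unions, their multiset being determined by `D(A)`.
-/

namespace HyperplaneArrangement

open SymmetricAlgebra

section SymmetricAlgebra

variable {K : Type*} [Field K] {M : Type*} [AddCommGroup M] [Module K M]
  {N : Type*} [AddCommGroup N] [Module K N]

theorem exists_derivation_ι_eq (φ : M →ₗ[K] SymmetricAlgebra K M) :
    ∃ D : Derivation K (SymmetricAlgebra K M) (SymmetricAlgebra K M),
      ∀ m, D (ι K M m) = φ m := by
  -- A derivation of `S` is the second component of a section of the dual numbers `S[ε] → S`.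
  let F : SymmetricAlgebra K M →ₐ[K]
      TrivSqZeroExt (SymmetricAlgebra K M) (SymmetricAlgebra K M) :=
    lift ((TrivSqZeroExt.inlAlgHom K (SymmetricAlgebra K M)
      (SymmetricAlgebra K M)).toLinearMap ∘ₗ ι K M +
      (TrivSqZeroExt.inrHom (SymmetricAlgebra K M) (SymmetricAlgebra K M)).restrictScalars K ∘ₗ φ)
  have hF (m : M) : F (ι K M m) = TrivSqZeroExt.inl (ι K M m) + TrivSqZeroExt.inr (φ m) :=
    lift_ι_apply _ m
  have hfst (a : SymmetricAlgebra K M) : (F a).fst = a := by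
    have : (TrivSqZeroExt.fstHom K (SymmetricAlgebra K M) (SymmetricAlgebra K M)).comp F =
        AlgHom.id K _ := algHom_ext (LinearMap.ext fun m => by simp [hF])
    exact DFunLike.congr_fun this a
  refine ⟨Derivation.mk' ((TrivSqZeroExt.sndHom (SymmetricAlgebra K M)
    (SymmetricAlgebra K M)).restrictScalars K ∘ₗ F.toLinearMap) fun a b => ?_, fun m => ?_⟩
  · simp [hfst, mul_comm]
  · simp [hF]

theorem derivation_eq_of_ι_eq {D₁ D₂ : Derivation K (SymmetricAlgebra K M) (SymmetricAlgebra K M)}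
    (h : ∀ m, D₁ (ι K M m) = D₂ (ι K M m)) : D₁ = D₂ := by
  ext a
  induction a using SymmetricAlgebra.induction with
  | algebraMap r => simp
  | ι x => exact h x
  | mul a b ha hb => simp [ha, hb]
  | add a b ha hb => simp [ha, hb]

theorem derivation_sum_smul_apply {κ : Type*} (s : Finset κ) (g : κ → SymmetricAlgebra K M)
    (θ : κ → Derivation K (SymmetricAlgebra K M) (SymmetricAlgebra K M))
    (a : SymmetricAlgebra K M) : (∑ j ∈ s, g j • θ j) a = ∑ j ∈ s, g j * θ j a := by
  rw [← Derivation.coeFnAddMonoidHom_apply, map_sum, Finset.sum_apply]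
  rfl

theorem exists_eq_smul_of_dvd_ι {a : SymmetricAlgebra K M} (ha : a ≠ 0)
    {θ : Derivation K (SymmetricAlgebra K M) (SymmetricAlgebra K M)}
    (h : ∀ m, a ∣ θ (ι K M m)) :
    ∃ η : Derivation K (SymmetricAlgebra K M) (SymmetricAlgebra K M), θ = a • η := by
  choose φ hφ using h
  obtain ⟨η, hη⟩ := exists_derivation_ι_eq (K := K) (M := M)
    { toFun := φ
      map_add' := fun x y => mul_left_cancel₀ ha (by
        rw [mul_add, ← hφ, ← hφ, ← hφ, map_add, map_add])
      map_smul' := fun c x => mul_left_cancel₀ ha (by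
        rw [RingHom.id_apply, mul_smul_comm, ← hφ, ← hφ, map_smul, Derivation.map_smul]) }
  refine ⟨η, derivation_eq_of_ι_eq fun m => ?_⟩
  rw [Derivation.smul_apply, hη]
  exact hφ m

variable (K M) in
/-- The algebra homomorphism `Sym M → (Sym M)[X]` with `m ↦ m X`. It encodes the grading of `Sym M`:
the coefficient of `X ^ d` in the image of `f` is the component of `f` of degree `d`. -/
noncomputable def gradingHom : SymmetricAlgebra K M →ₐ[K] Polynomial (SymmetricAlgebra K M) :=
  lift ((Polynomial.monomial 1).restrictScalars K ∘ₗ ι K M)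

@[simp]
theorem gradingHom_ι (m : M) : gradingHom K M (ι K M m) = Polynomial.monomial 1 (ι K M m) :=
  lift_ι_apply _ m

theorem gradingHom_of_mem {d : ℕ} {f : SymmetricAlgebra K M}
    (hf : f ∈ LinearMap.range (ι K M) ^ d) : gradingHom K M f = Polynomial.monomial d f := by
  induction d generalizing f with
  | zero =>
    rw [pow_zero, Submodule.mem_one] at hf
    obtain ⟨r, rfl⟩ := hf
    rw [AlgHom.commutes]
    rfl
  | succ n ih =>
    rw [pow_succ] at hf
    refine Submodule.mul_induction_on hf (fun a ha b hb => ?_) (fun a b ha hb => ?_)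
    · obtain ⟨m, rfl⟩ := hb
      rw [map_mul, ih ha, gradingHom_ι, Polynomial.monomial_mul_monomial]
    · rw [map_add, ha, hb, map_add]

theorem coeff_gradingHom_mem (d : ℕ) (f : SymmetricAlgebra K M) :
    (gradingHom K M f).coeff d ∈ LinearMap.range (ι K M) ^ d := by
  have of_mem {e : ℕ} {h : SymmetricAlgebra K M} (hh : h ∈ LinearMap.range (ι K M) ^ e) (d : ℕ) :
      (gradingHom K M h).coeff d ∈ LinearMap.range (ι K M) ^ d := by
    rw [gradingHom_of_mem hh, Polynomial.coeff_monomial]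
    split_ifs with hed
    · rwa [← hed]
    · exact zero_mem _
  induction f using SymmetricAlgebra.induction generalizing d with
  | algebraMap r => exact of_mem (e := 0) (by rw [pow_zero]; exact Submodule.algebraMap_mem r) d
  | ι x => exact of_mem (e := 1) (by rw [pow_one]; exact ⟨x, rfl⟩) d
  | mul a b ha hb =>
    rw [map_mul, Polynomial.coeff_mul]
    refine sum_mem fun p hp => ?_
    rw [← Finset.HasAntidiagonal.mem_antidiagonal.1 hp, pow_add]
    exact Submodule.mul_mem_mul (ha _) (hb _)
  | add a b ha hb =>
    rw [map_add, Polynomial.coeff_add]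
    exact add_mem (ha _) (hb _)

theorem coeff_gradingHom_mul_of_mem {e : ℕ} {h : SymmetricAlgebra K M}
    (hh : h ∈ LinearMap.range (ι K M) ^ e) (d : ℕ) (g : SymmetricAlgebra K M) :
    (gradingHom K M (g * h)).coeff d =
      if e ≤ d then (gradingHom K M g).coeff (d - e) * h else 0 := by
  rw [map_mul, gradingHom_of_mem hh, ← Polynomial.C_mul_X_pow_eq_monomial, ← mul_assoc,
    Polynomial.coeff_mul_X_pow', Polynomial.coeff_mul_C]

theorem exists_eq_mul_of_dvd_of_mem {q f : SymmetricAlgebra K M} {m d : ℕ}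
    (hq : q ∈ LinearMap.range (ι K M) ^ m) (hf : f ∈ LinearMap.range (ι K M) ^ d) (h : q ∣ f)
    (hf₀ : f ≠ 0) : m ≤ d ∧ ∃ g ∈ LinearMap.range (ι K M) ^ (d - m), f = g * q := by
  obtain ⟨g, rfl⟩ := h
  have hcomp := coeff_gradingHom_mul_of_mem hq d g
  rw [mul_comm g, gradingHom_of_mem hf, Polynomial.coeff_monomial_same] at hcomp
  split_ifs at hcomp with hmd
  · exact ⟨hmd, _, coeff_gradingHom_mem _ _, hcomp⟩
  · exact absurd hcomp hf₀

theorem ι_injective : Function.Injective (ι K M) :=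
  (injective_iff_map_eq_zero _).2 fun m hm =>
    (Module.forall_dual_apply_eq_zero_iff K m).1 fun φ => by
      rw [← lift_ι_apply φ m, hm, map_zero]

theorem ι_ne_zero {m : M} (hm : m ≠ 0) : ι K M m ≠ 0 :=
  (map_ne_zero_iff _ ι_injective).2 hm

instance uniqueFactorizationMonoid_symmetricAlgebra :
    UniqueFactorizationMonoid (SymmetricAlgebra K M) :=
  (equivMvPolynomial (Module.Free.chooseBasis K M)).toMulEquiv.symm.uniqueFactorizationMonoid
    inferInstance

theorem prod_ι_mem_pow_card {κ : Type*} (s : Finset κ) (m : κ → M) :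
    ∏ i ∈ s, ι K M (m i) ∈ LinearMap.range (ι K M) ^ s.card := by
  classical
  induction s using Finset.induction with
  | empty => simp
  | insert i s hi ih =>
    rw [Finset.prod_insert hi, Finset.card_insert_of_notMem hi, pow_succ']
    exact Submodule.mul_mem_mul ⟨_, rfl⟩ ih

/-- The homomorphism `Sym M → Sym N` induced by a linear map `M → N`. -/
noncomputable def symMap (p : M →ₗ[K] N) : SymmetricAlgebra K M →ₐ[K] SymmetricAlgebra K N :=
  lift (ι K N ∘ₗ p)

@[simp]
theorem symMap_ι (p : M →ₗ[K] N) (m : M) : symMap p (ι K M m) = ι K N (p m) :=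
  lift_ι_apply _ m

theorem symMap_mem (p : M →ₗ[K] N) {d : ℕ} {f : SymmetricAlgebra K M}
    (hf : f ∈ LinearMap.range (ι K M) ^ d) : symMap p f ∈ LinearMap.range (ι K N) ^ d := by
  have h := Submodule.mem_map_of_mem (f := (symMap p).toLinearMap) hf
  rw [Submodule.map_pow] at h
  refine SetLike.le_def.1 (pow_le_pow_left' ?_ d) h
  rintro _ ⟨_, ⟨m, rfl⟩, rfl⟩
  exact ⟨p m, (symMap_ι p m).symm⟩

theorem symMap_symMap_of_rightInverse {p : M →ₗ[K] N} {σ : N →ₗ[K] M}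
    (h : Function.RightInverse σ p) (f : SymmetricAlgebra K N) : symMap p (symMap σ f) = f := by
  have : (symMap p).comp (symMap σ) = AlgHom.id K _ :=
    algHom_ext (LinearMap.ext fun n => by simp [h n])
  exact DFunLike.congr_fun this f

theorem exists_rightInverse_of_surjective {p : M →ₗ[K] N} (hp : Function.Surjective p) :
    ∃ σ : N →ₗ[K] M, Function.RightInverse σ p :=
  (p.exists_rightInverse_of_surjective (LinearMap.range_eq_top.2 hp)).imp
    fun _ hσ n => DFunLike.congr_fun hσ n

theorem exists_mem_symMap_eq {p : M →ₗ[K] N} (hp : Function.Surjective p) {d : ℕ}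
    {f : SymmetricAlgebra K N} (hf : f ∈ LinearMap.range (ι K N) ^ d) :
    ∃ g ∈ LinearMap.range (ι K M) ^ d, symMap p g = f := by
  obtain ⟨σ, hσ⟩ := exists_rightInverse_of_surjective hp
  exact ⟨symMap σ f, symMap_mem σ hf, symMap_symMap_of_rightInverse hσ f⟩

theorem symMap_surjective {p : M →ₗ[K] N} (hp : Function.Surjective p) :
    Function.Surjective (symMap p) := by
  obtain ⟨σ, hσ⟩ := exists_rightInverse_of_surjective hp
  exact fun f => ⟨symMap σ f, symMap_symMap_of_rightInverse hσ f⟩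

theorem symMap_eq_zero_iff {p : M →ₗ[K] N} (hp : Function.Surjective p) {a : M}
    (ha : LinearMap.ker p = K ∙ a) (f : SymmetricAlgebra K M) :
    symMap p f = 0 ↔ ι K M a ∣ f := by
  obtain ⟨σ, hσ⟩ := exists_rightInverse_of_surjective hp
  have dvd_sub (f : SymmetricAlgebra K M) : ι K M a ∣ f - symMap σ (symMap p f) := by
    induction f using SymmetricAlgebra.induction with
    | algebraMap r => simp
    | ι x =>
      have hx : x - σ (p x) ∈ LinearMap.ker p := by simp [hσ (p x)]
      rw [ha, Submodule.mem_span_singleton] at hx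
      obtain ⟨c, hc⟩ := hx
      rw [symMap_ι, symMap_ι, ← map_sub, ← hc, map_smul, Algebra.smul_def]
      exact dvd_mul_left _ _
    | mul x y hx hy =>
      rw [map_mul, map_mul]
      exact dvd_mul_sub_mul hx hy
    | add x y hx hy =>
      rw [map_add, map_add, add_sub_add_comm]
      exact dvd_add hx hy
  constructor
  · intro h
    simpa [h] using dvd_sub f
  · rintro ⟨g, rfl⟩
    have : p a = 0 := by
      rw [← LinearMap.mem_ker, ha]
      exact Submodule.mem_span_singleton_self a
    simp [this]

theorem ι_dvd_iff (a : M) (f : SymmetricAlgebra K M) :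
    ι K M a ∣ f ↔ symMap (K ∙ a).mkQ f = 0 :=
  (symMap_eq_zero_iff (Submodule.mkQ_surjective _) (Submodule.ker_mkQ _) f).symm

theorem prime_ι {a : M} (ha : a ≠ 0) : Prime (ι K M a) := by
  refine ⟨ι_ne_zero ha, fun hu => ?_, fun x y hxy => ?_⟩
  · simpa [ι_dvd_iff] using isUnit_iff_dvd_one.1 hu
  · simpa only [ι_dvd_iff, map_mul, mul_eq_zero] using hxy

theorem exists_eq_smul_of_ι_dvd_ι {a b : M} (h : ι K M a ∣ ι K M b) : ∃ c : K, b = c • a := by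
  rw [ι_dvd_iff, symMap_ι, map_eq_zero_iff _ ι_injective, ← LinearMap.mem_ker, Submodule.ker_mkQ,
    Submodule.mem_span_singleton] at h
  exact h.imp fun _ hc => hc.symm

theorem exists_derivation_symMap {p : M →ₗ[K] N} (hp : Function.Surjective p)
    {θ : Derivation K (SymmetricAlgebra K M) (SymmetricAlgebra K M)}
    (hθ : ∀ m ∈ LinearMap.ker p, symMap p (θ (ι K M m)) = 0) :
    ∃ η : Derivation K (SymmetricAlgebra K N) (SymmetricAlgebra K N),
      ∀ m, η (ι K N (p m)) = symMap p (θ (ι K M m)) := by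
  obtain ⟨σ, hσ⟩ := exists_rightInverse_of_surjective hp
  obtain ⟨η, hη⟩ := exists_derivation_ι_eq
    ((symMap p).toLinearMap ∘ₗ θ.toLinearMap ∘ₗ ι K M ∘ₗ σ)
  refine ⟨η, fun m => ?_⟩
  have h := hθ (σ (p m) - m) (by simp [hσ (p m)])
  rw [map_sub, map_sub, map_sub, sub_eq_zero] at h
  exact (hη _).trans h

end SymmetricAlgebra

theorem eq_of_forall_countP_lt_eq {E F : Multiset ℕ}
    (h : ∀ k, E.countP (· < k) = F.countP (· < k)) : E = F := by
  have countP_lt_succ (G : Multiset ℕ) (k : ℕ) :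
      G.countP (· < k + 1) = G.countP (· < k) + G.count k := by
    induction G using Multiset.induction with
    | empty => simp
    | cons a G ih =>
      simp only [Multiset.countP_cons, Multiset.count_cons, ih]
      split_ifs <;> omega
  ext k
  have hk := h (k + 1)
  rwa [countP_lt_succ, countP_lt_succ, h k, Nat.add_left_cancel_iff] at hk

theorem countP_map_univ {κ : Type*} [Fintype κ] (d : κ → ℕ) (p : ℕ → Prop) [DecidablePred p] :
    (Finset.univ.val.map d).countP p = Fintype.card {i // p (d i)} := by
  rw [Multiset.countP_map, Fintype.card_subtype]
  rfl

section Derivations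

variable {K : Type*} [Field K] {V : Type*} [AddCommGroup V] [Module K V]

local notation "Sym" => SymmetricAlgebra K (Module.Dual K V)
local notation "Der" => Derivation K Sym Sym

theorem IsHomogeneousDerivation.smul {f : Sym} {k d : ℕ} {θ : Der}
    (hf : f ∈ LinearMap.range (ι K (Module.Dual K V)) ^ k) (hθ : IsHomogeneousDerivation θ d) :
    IsHomogeneousDerivation (f • θ) (k + d) := fun α => by
  rw [pow_add]
  exact Submodule.mul_mem_mul hf (hθ α)

theorem IsHomogeneousDerivation.sub {d : ℕ} {θ η : Der} (hθ : IsHomogeneousDerivation θ d)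
    (hη : IsHomogeneousDerivation η d) : IsHomogeneousDerivation (θ - η) d :=
  fun α => sub_mem (hθ α) (hη α)

theorem isHomogeneousDerivation_zero (d : ℕ) : IsHomogeneousDerivation (0 : Der) d :=
  fun _ => zero_mem _

/-- `θ` is a basis of the `S`-module `D` of derivations of `S = Sym(V*)`, and `θ i` is homogeneous
of polynomial degree `d i`. -/
structure IsHomogeneousBasis {κ : Type*} (D : Submodule Sym Der) (θ : κ → Der) (d : κ → ℕ) :
    Prop where
  linearIndependent : LinearIndependent Sym θ
  span_range : Submodule.span Sym (Set.range θ) = D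
  homogeneous : ∀ i, IsHomogeneousDerivation (θ i) (d i)

namespace IsHomogeneousBasis

theorem mem {κ : Type*} {D : Submodule Sym Der} {θ : κ → Der} {d : κ → ℕ}
    (hθ : IsHomogeneousBasis D θ d) (i : κ) : θ i ∈ D :=
  hθ.span_range ▸ Submodule.subset_span ⟨i, rfl⟩

theorem exists_eq_sum {κ : Type*} [Fintype κ] {D : Submodule Sym Der} {θ : κ → Der}
    {d : κ → ℕ} (hθ : IsHomogeneousBasis D θ d) {η : Der} (hη : η ∈ D) :
    ∃ g : κ → Sym, ∑ i, g i • θ i = η := by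
  rwa [← hθ.span_range, Submodule.mem_span_range_iff_exists_fun] at hη

theorem coeff_eq_zero_of_lt {κ : Type*} [Fintype κ] {D : Submodule Sym Der}
    {θ : κ → Der} {d : κ → ℕ} (hθ : IsHomogeneousBasis D θ d) {g : κ → Sym} {e : ℕ}
    (hg : IsHomogeneousDerivation (∑ i, g i • θ i) e) {i : κ} (hi : e < d i) : g i = 0 := by
  let g' (j : κ) : Sym := if d j ≤ e then (gradingHom K _ (g j)).coeff (e - d j) else 0
  have hsum : ∑ j, g j • θ j = ∑ j, g' j • θ j := by
    refine derivation_eq_of_ι_eq fun α => ?_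
    have hcoeff := congrArg (Polynomial.coeff · e) (gradingHom_of_mem (hg α))
    simp only [Polynomial.coeff_monomial_same] at hcoeff
    rw [← hcoeff, derivation_sum_smul_apply, derivation_sum_smul_apply, map_sum,
      Polynomial.finsetSum_coeff]
    refine Finset.sum_congr rfl fun j _ => ?_
    rw [coeff_gradingHom_mul_of_mem (hθ.homogeneous j α), ite_mul, zero_mul]
  rw [Fintype.linearIndependent_iffₛ.1 hθ.linearIndependent _ _ hsum i]
  exact if_neg hi.not_ge

theorem card_le_card_lt {κ κ' : Type*} [Fintype κ] [Fintype κ'] {D : Submodule Sym Der}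
    {θ : κ → Der} {d : κ → ℕ} (hθ : IsHomogeneousBasis D θ d) {k : ℕ} {η : κ' → Der}
    (hη : LinearIndependent Sym η) (hmem : ∀ j, η j ∈ D) {e : κ' → ℕ}
    (he : ∀ j, IsHomogeneousDerivation (η j) (e j)) (hk : ∀ j, e j < k) :
    Fintype.card κ' ≤ Fintype.card {i // d i < k} := by
  classical
  let w : Set Der := Set.range fun i : {i // d i < k} => θ i
  have hw : Set.range η ≤ Submodule.span Sym w := by
    rintro _ ⟨j, rfl⟩
    obtain ⟨g, hg⟩ := hθ.exists_eq_sum (hmem j)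
    rw [SetLike.mem_coe, ← hg]
    refine Submodule.sum_mem _ fun i _ => ?_
    rcases lt_or_ge (d i) k with hi | hi
    · exact Submodule.smul_mem _ _ (Submodule.subset_span ⟨⟨i, hi⟩, rfl⟩)
    · have hgi : g i = 0 := hθ.coeff_eq_zero_of_lt (hg ▸ he j) ((hk j).trans_le hi)
      rw [hgi, zero_smul]
      exact zero_mem _
  exact (linearIndependent_le_span_aux' η hη w hw).trans (Fintype.card_range_le _)

theorem sub_smul {κ : Type*} {D : Submodule Sym Der} {θ : κ → Der} {d : κ → ℕ}
    (hθ : IsHomogeneousBasis D θ d) {l : κ} {f : κ → Sym} (hfl : f l = 0)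
    (hf : ∀ i, IsHomogeneousDerivation (f i • θ l) (d i)) :
    IsHomogeneousBasis D (fun i => θ i - f i • θ l) d where
  linearIndependent := by
    have h := (linearIndependent_add_smul_iff (v := θ) (c := -f) (i := l) (by simp [hfl])).2
      hθ.linearIndependent
    have heq : (fun i => θ i - f i • θ l) = θ + fun i => (-f) i • θ l := by
      ext1 i
      exact (sub_eq_add_neg _ _).trans (congrArg (θ i + ·) (neg_smul (f i) (θ l)).symm)
    exact heq ▸ h
  span_range := by
    refine le_antisymm (Submodule.span_le.2 ?_) (hθ.span_range ▸ Submodule.span_le.2 ?_)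
    · rintro _ ⟨i, rfl⟩
      exact sub_mem (hθ.mem i) (D.smul_mem _ (hθ.mem l))
    · rintro _ ⟨i, rfl⟩
      have hl : θ l ∈ Submodule.span Sym (Set.range fun i => θ i - f i • θ l) :=
        Submodule.subset_span ⟨l, by simp [hfl]⟩
      rw [← sub_add_cancel (θ i) (f i • θ l)]
      exact add_mem (Submodule.subset_span ⟨i, rfl⟩) (Submodule.smul_mem _ _ hl)
  homogeneous i := (hθ.homogeneous i).sub (hf i)

theorem isFreeWithExponents {κ : Type*} [Fintype κ] {θ : κ → Der} {d : κ → ℕ}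
    {A : HyperplaneArrangement K V} (hθ : IsHomogeneousBasis A.derivationModule θ d) :
    A.IsFreeWithExponents (Finset.univ.val.map d) := by
  let e := Fintype.equivFin κ
  let b := ((Module.Basis.span hθ.linearIndependent).map
    (LinearEquiv.ofEq _ _ hθ.span_range)).reindex e
  refine ⟨_, b, d ∘ e.symm, fun i => ?_, ?_⟩
  · have hb : (b i).1 = θ (e.symm i) := by simp [b, Module.Basis.span_apply]
    rw [hb]
    exact hθ.homogeneous _
  · rw [← Multiset.map_map, Multiset.map_univ_val_equiv]

end IsHomogeneousBasis

theorem IsFreeWithExponents.exists_isHomogeneousBasis {A : HyperplaneArrangement K V}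
    {E : Multiset ℕ} (h : A.IsFreeWithExponents E) :
    ∃ (n : ℕ) (θ : Fin n → Der) (d : Fin n → ℕ),
      IsHomogeneousBasis A.derivationModule θ d ∧ E = Finset.univ.val.map d := by
  obtain ⟨n, b, d, hd, hE⟩ := h
  refine ⟨n, fun i => (b i).1, d, ⟨?_, ?_, hd⟩, hE⟩
  · exact b.linearIndependent.map_injOn A.derivationModule.subtype Subtype.val_injective.injOn
  · have : Set.range (fun i => (b i).1) = A.derivationModule.subtype '' Set.range b := by
      rw [← Set.range_comp]
      rfl
    rw [this, Submodule.span_image, b.span_eq, Submodule.map_top, Submodule.range_subtype]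

theorem IsFreeWithExponents.countP_lt_le {A : HyperplaneArrangement K V} {E F : Multiset ℕ}
    (hE : A.IsFreeWithExponents E) (hF : A.IsFreeWithExponents F) (k : ℕ) :
    E.countP (· < k) ≤ F.countP (· < k) := by
  obtain ⟨n, θ, d, hθ, rfl⟩ := hE.exists_isHomogeneousBasis
  obtain ⟨m, ψ, e, hψ, rfl⟩ := hF.exists_isHomogeneousBasis
  rw [countP_map_univ, countP_map_univ]
  exact hψ.card_le_card_lt (hθ.linearIndependent.comp _ Subtype.val_injective)
    (fun i => hθ.mem i) (fun i => hθ.homogeneous i) fun i : {i // d i < k} => i.2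

theorem IsFreeWithExponents.unique {A : HyperplaneArrangement K V} {E F : Multiset ℕ}
    (hE : A.IsFreeWithExponents E) (hF : A.IsFreeWithExponents F) : E = F :=
  eq_of_forall_countP_lt_eq fun k => le_antisymm (hE.countP_lt_le hF k) (hF.countP_lt_le hE k)

theorem exists_dual_derivations {κ : Type*} [DecidableEq κ]
    (b : Module.Basis κ K (Module.Dual K V)) :
    ∃ θ : κ → Der, (∀ i j, θ i (ι K _ (b j)) = if i = j then 1 else 0) ∧
      ∀ i, IsHomogeneousDerivation (θ i) 0 := by
  choose θ hθ using fun i => exists_derivation_ι_eq (Algebra.linearMap K Sym ∘ₗ b.coord i)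
  refine ⟨θ, fun i j => ?_, fun i α => ?_⟩
  · simp [hθ, Finsupp.single_apply, eq_comm]
  · rw [hθ, pow_zero]
    exact Submodule.algebraMap_mem _

theorem derivationModule_empty : (empty K V).derivationModule = ⊤ :=
  eq_top_iff.2 fun _ _ _ hH => hH.elim

theorem isFreeWithExponents_empty [FiniteDimensional K V] :
    (empty K V).IsFreeWithExponents (Multiset.replicate (Module.finrank K V) 0) := by
  let b := Module.finBasis K (Module.Dual K V)
  obtain ⟨θ, hθb, hθ⟩ := exists_dual_derivations b
  have sum_apply (g : Fin (Module.finrank K (Module.Dual K V)) → Sym) (j) :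
      (∑ i, g i • θ i) (ι K _ (b j)) = g j := by
    simp [derivation_sum_smul_apply, hθb]
  have sum_eq (η : Der) : ∑ i, η (ι K _ (b i)) • θ i = η := by
    have : (∑ i, η (ι K _ (b i)) • θ i).toLinearMap ∘ₗ ι K _ = η.toLinearMap ∘ₗ ι K _ :=
      b.ext fun j => sum_apply _ j
    exact derivation_eq_of_ι_eq fun α => DFunLike.congr_fun this α
  have hbasis : IsHomogeneousBasis (empty K V).derivationModule θ fun _ => 0 :=
    { linearIndependent := Fintype.linearIndependent_iff.2 fun g hg j => by
        rw [← sum_apply g j, hg]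
        rfl
      span_range := by
        rw [derivationModule_empty, eq_top_iff]
        exact fun η _ => (Submodule.mem_span_range_iff_exists_fun _).2 ⟨_, sum_eq η⟩
      homogeneous := hθ }
  convert hbasis.isFreeWithExponents
  rw [Multiset.map_const', Finset.card_val, Finset.card_fin, Subspace.dual_finrank_eq]

end Derivations

section Restriction

variable {K : Type*} [Field K] {V : Type*} [AddCommGroup V] [Module K V]

local notation "Sym" => SymmetricAlgebra K (Module.Dual K V)
local notation "Der" => Derivation K Sym Sym

theorem exists_eq_smul_of_ker_le {α β : Module.Dual K V} (h : LinearMap.ker α ≤ LinearMap.ker β) :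
    ∃ c : K, β = c • α := by
  have hβ := mem_span_of_iInf_ker_le_ker (ι := Unit) (L := fun _ => α) (by simpa using h)
  rw [Set.range_const, Submodule.mem_span_singleton] at hβ
  exact hβ.imp fun _ => Eq.symm

/-- A linear form `α_H` with kernel `H`. This is a junk value unless `H` is a hyperplane or the
whole space. -/
noncomputable def definingForm (H : Submodule K V) : Module.Dual K V :=
  Classical.epsilon fun α => LinearMap.ker α = H

/-- The linear form `α_H` as an element of `S = Sym(V*)`. -/
noncomputable abbrev definingPolynomial (H : Submodule K V) : Sym :=
  ι K _ (definingForm H)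

theorem ker_definingForm {H : Submodule K V} (hH : IsCoatom H) :
    LinearMap.ker (definingForm H) = H := by
  refine Classical.epsilon_spec (p := fun α : Module.Dual K V => LinearMap.ker α = H) ?_
  obtain ⟨α, hα, hle⟩ := H.exists_le_ker_of_lt_top hH.lt_top
  exact ⟨α, (hH.le_iff.1 hle).resolve_left (mt LinearMap.ker_eq_top.1 hα)⟩

theorem definingForm_ne_zero {H : Submodule K V} (hH : IsCoatom H) : definingForm H ≠ 0 := by
  intro h
  exact hH.ne_top (by rw [← ker_definingForm hH, h, LinearMap.ker_zero])

theorem prime_definingPolynomial {H : Submodule K V} (hH : IsCoatom H) :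
    Prime (definingPolynomial H) :=
  prime_ι (definingForm_ne_zero hH)

theorem exists_eq_smul_definingForm {H : Submodule K V} (hH : IsCoatom H) {β : Module.Dual K V}
    (hβ : H ≤ LinearMap.ker β) : ∃ c : K, β = c • definingForm H :=
  exists_eq_smul_of_ker_le ((ker_definingForm hH).trans_le hβ)

theorem ker_eq_of_ι_dvd_ι {α β : Module.Dual K V} (hβ : β ≠ 0) (h : ι K _ α ∣ ι K _ β) :
    LinearMap.ker α = LinearMap.ker β := by
  obtain ⟨c, rfl⟩ := exists_eq_smul_of_ι_dvd_ι h
  exact (LinearMap.ker_smul α c (left_ne_zero_of_smul hβ)).symm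

theorem isRelPrime_ι {α β : Module.Dual K V} (hα : α ≠ 0) (hβ : β ≠ 0)
    (h : LinearMap.ker α ≠ LinearMap.ker β) : IsRelPrime (ι K _ α) (ι K _ β) :=
  (prime_ι hα).irreducible.isRelPrime_iff_not_dvd.2 (mt (ker_eq_of_ι_dvd_ι hβ) h)

theorem eq_of_definingPolynomial_dvd {H X : Submodule K V} (hH : IsCoatom H) (hX : IsCoatom X)
    (h : definingPolynomial H ∣ definingPolynomial X) : H = X := by
  rw [← ker_definingForm hH, ker_eq_of_ι_dvd_ι (definingForm_ne_zero hX) h, ker_definingForm hX]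

theorem mem_derivationModule_iff {A : HyperplaneArrangement K V} {θ : Der} :
    θ ∈ A.derivationModule ↔
      ∀ H ∈ A.hyperplanes, definingPolynomial H ∣ θ (definingPolynomial H) := by
  refine ⟨fun h H hH => h H hH _ (ker_definingForm (A.isCoatom H hH)), fun h H hH α hα => ?_⟩
  obtain ⟨c, rfl⟩ := exists_eq_smul_definingForm (A.isCoatom H hH) hα.ge
  rw [map_smul, Derivation.map_smul, Algebra.smul_def, Algebra.smul_def]
  exact mul_dvd_mul_left _ (h H hH)

theorem mem_derivationModule_iff_deletion {A : HyperplaneArrangement K V} {H₀ : Submodule K V}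
    (h₀ : H₀ ∈ A.hyperplanes) {θ : Der} :
    θ ∈ A.derivationModule ↔ θ ∈ (A.deletion H₀).derivationModule ∧
      definingPolynomial H₀ ∣ θ (definingPolynomial H₀) := by
  simp only [mem_derivationModule_iff]
  refine ⟨fun h => ⟨fun H hH => h H hH.1, h H₀ h₀⟩, fun h H hH => ?_⟩
  by_cases hHH₀ : H = H₀
  · exact hHH₀ ▸ h.2
  · exact h.1 H ⟨hH, hHH₀⟩

theorem mem_derivationModule_deletion_of_smul_mem {A : HyperplaneArrangement K V}
    {H₀ : Submodule K V} (h₀ : IsCoatom H₀) {η : Der}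
    (h : definingPolynomial H₀ • η ∈ (A.deletion H₀).derivationModule) :
    η ∈ (A.deletion H₀).derivationModule := by
  rw [mem_derivationModule_iff] at h ⊢
  intro H hH
  have hcoatom := A.isCoatom H hH.1
  exact ((prime_definingPolynomial hcoatom).dvd_or_dvd (h H hH)).resolve_left
    fun hdvd => hH.2 (eq_of_definingPolynomial_dvd hcoatom h₀ hdvd)

theorem ker_dualRestrict {H : Submodule K V} (hH : IsCoatom H) :
    LinearMap.ker H.dualRestrict = K ∙ definingForm H := by
  rw [Submodule.dualRestrict_ker_eq_dualAnnihilator]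
  refine le_antisymm (fun β hβ => ?_) ((Submodule.span_singleton_le_iff_mem _ _).2 ?_)
  · obtain ⟨c, rfl⟩ := exists_eq_smul_definingForm hH
      fun v hv => LinearMap.mem_ker.2 ((Submodule.mem_dualAnnihilator β).1 hβ v hv)
    exact Submodule.smul_mem _ c (Submodule.mem_span_singleton_self _)
  · refine (Submodule.mem_dualAnnihilator _).2 fun v hv => ?_
    rwa [← LinearMap.mem_ker, ker_definingForm hH]

theorem ker_dualRestrict_definingForm {H : Submodule K V} (hH : IsCoatom H) (X : Submodule K V) :
    LinearMap.ker (X.dualRestrict (definingForm H)) = interIn X H :=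
  congrArg (Submodule.comap X.subtype) (ker_definingForm hH)

/-- The homomorphism `Sym(V*) → Sym(X*)` of restriction of polynomial functions to `X`. -/
noncomputable abbrev symRestrict (X : Submodule K V) :
    Sym →ₐ[K] SymmetricAlgebra K (Module.Dual K X) :=
  symMap X.dualRestrict

theorem symRestrict_eq_zero_iff {H : Submodule K V} (hH : IsCoatom H) (f : Sym) :
    symRestrict H f = 0 ↔ definingPolynomial H ∣ f :=
  symMap_eq_zero_iff Subspace.dualRestrict_surjective (ker_dualRestrict hH) f

theorem exists_restriction_derivation {A : HyperplaneArrangement K V} {H₀ : Submodule K V}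
    (h₀ : H₀ ∈ A.hyperplanes) {θ : Der} (hθ : θ ∈ A.derivationModule) :
    ∃ η ∈ (A.restriction H₀).derivationModule, ∀ α,
      η (ι K _ (H₀.dualRestrict α)) = symRestrict H₀ (θ (ι K _ α)) := by
  rw [mem_derivationModule_iff] at hθ
  have restrict_eq_zero : ∀ α ∈ LinearMap.ker H₀.dualRestrict,
      symRestrict H₀ (θ (ι K _ α)) = 0 := by
    intro α hα
    rw [ker_dualRestrict (A.isCoatom _ h₀), Submodule.mem_span_singleton] at hα
    obtain ⟨c, rfl⟩ := hα
    rw [map_smul, Derivation.map_smul, map_smul,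
      (symRestrict_eq_zero_iff (A.isCoatom _ h₀) _).2 (hθ H₀ h₀), smul_zero]
  obtain ⟨η, hη⟩ := exists_derivation_symMap Subspace.dualRestrict_surjective restrict_eq_zero
  refine ⟨η, ?_, hη⟩
  rintro _ ⟨H, ⟨hH, -⟩, rfl⟩ β hβ
  obtain ⟨c, rfl⟩ := exists_eq_smul_of_ker_le
    ((ker_dualRestrict_definingForm (A.isCoatom H hH) H₀).trans hβ.symm).le
  rw [map_smul, Derivation.map_smul, Algebra.smul_def, Algebra.smul_def, hη, ← symMap_ι]
  exact mul_dvd_mul_left _ (map_dvd (symRestrict H₀) (hθ H hH))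

theorem IsHomogeneousBasis.definingPolynomial_dvd_coeff {A : HyperplaneArrangement K V}
    {H₀ : Submodule K V} (h₀ : IsCoatom H₀) {κ : Type*} [Fintype κ] {θ : κ → Der} {d : κ → ℕ}
    (hθ : IsHomogeneousBasis (A.deletion H₀).derivationModule θ d) {g : κ → Sym}
    (hg : ∀ α, definingPolynomial H₀ ∣ (∑ i, g i • θ i) (ι K _ α)) (i : κ) :
    definingPolynomial H₀ ∣ g i := by
  obtain ⟨η, hη⟩ := exists_eq_smul_of_dvd_ι (prime_definingPolynomial h₀).ne_zero hg
  have hηmem : η ∈ (A.deletion H₀).derivationModule := by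
    refine mem_derivationModule_deletion_of_smul_mem h₀ ?_
    rw [← hη]
    exact Submodule.sum_mem _ fun i _ => Submodule.smul_mem _ _ (hθ.mem i)
  obtain ⟨f, rfl⟩ := hθ.exists_eq_sum hηmem
  have hsum : ∑ i, g i • θ i = ∑ i, (definingPolynomial H₀ * f i) • θ i := by
    rw [hη, Finset.smul_sum]
    exact Finset.sum_congr rfl fun i _ => smul_smul _ _ _
  exact ⟨f i, Fintype.linearIndependent_iffₛ.1 hθ.linearIndependent _ _ hsum i⟩

theorem IsHomogeneousBasis.linearIndependent_symRestrict {A : HyperplaneArrangement K V}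
    {H₀ : Submodule K V} (h₀ : IsCoatom H₀) {κ : Type*} [Finite κ] {θ : κ → Der} {d : κ → ℕ}
    (hθ : IsHomogeneousBasis (A.deletion H₀).derivationModule θ d) :
    LinearIndependent (SymmetricAlgebra K (Module.Dual K H₀))
      fun i (α : Module.Dual K V) => symRestrict H₀ (θ i (ι K _ α)) := by
  cases nonempty_fintype κ
  refine Fintype.linearIndependent_iff.2 fun c hc i => ?_
  choose g hg using fun i => symMap_surjective (Subspace.dualRestrict_surjective (W := H₀)) (c i)
  rw [← hg i, symRestrict_eq_zero_iff h₀]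
  refine hθ.definingPolynomial_dvd_coeff h₀ (fun α => ?_) i
  rw [← symRestrict_eq_zero_iff h₀, derivation_sum_smul_apply, map_sum]
  simpa only [map_mul, hg, Finset.sum_apply, Pi.smul_apply, smul_eq_mul,
    Pi.zero_apply] using congrFun hc α

theorem IsHomogeneousBasis.card_degree_lt_le_countP {A : HyperplaneArrangement K V}
    {H₀ : Submodule K V} (h₀ : H₀ ∈ A.hyperplanes) {κ : Type*} [Fintype κ] {θ : κ → Der}
    {d : κ → ℕ} (hθ : IsHomogeneousBasis (A.deletion H₀).derivationModule θ d) {k : ℕ}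
    (hk : ∀ i, d i < k → θ i ∈ A.derivationModule) {E : Multiset ℕ}
    (hE : (A.restriction H₀).IsFreeWithExponents E) :
    Fintype.card {i // d i < k} ≤ E.countP (· < k) := by
  obtain ⟨n, ψ, e, hψ, rfl⟩ := hE.exists_isHomogeneousBasis
  choose η hη hηθ using fun i : {i // d i < k} => exists_restriction_derivation h₀ (hk i i.2)
  let eval : Derivation K _ _ →ₗ[SymmetricAlgebra K (Module.Dual K H₀)]
      Module.Dual K V → SymmetricAlgebra K (Module.Dual K H₀) :=
    { toFun D α := D (ι K _ (H₀.dualRestrict α))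
      map_add' _ _ := rfl
      map_smul' _ _ := rfl }
  have hindep : LinearIndependent (SymmetricAlgebra K (Module.Dual K H₀)) η := by
    refine LinearIndependent.of_comp eval ?_
    convert (hθ.linearIndependent_symRestrict (A.isCoatom H₀ h₀)).comp
      (Subtype.val : {i // d i < k} → κ) Subtype.val_injective using 1
    exact funext fun i => funext (hηθ i)
  have hhom (i) : IsHomogeneousDerivation (η i) (d i) := by
    intro β
    obtain ⟨α, rfl⟩ := Subspace.dualRestrict_surjective (W := H₀) β
    exact hηθ i α ▸ symMap_mem _ (hθ.homogeneous i α)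
  rw [countP_map_univ]
  exact hψ.card_le_card_lt hindep hη hhom fun i => i.2

end Restriction

section HomogeneousDivision

variable {K : Type*} [Field K] {M : Type*} [AddCommGroup M] [Module K M]
  {N : Type*} [AddCommGroup N] [Module K N]

theorem dvd_of_dvd_of_mem_pow {m : ℕ} {q f : SymmetricAlgebra K M}
    (hq : q ∈ LinearMap.range (ι K M) ^ m) (hf : f ∈ LinearMap.range (ι K M) ^ m) (h : q ∣ f)
    (hf₀ : f ≠ 0) : f ∣ q := by
  obtain ⟨-, g, hg, rfl⟩ := exists_eq_mul_of_dvd_of_mem hq hf h hf₀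
  rw [Nat.sub_self, pow_zero, Submodule.mem_one] at hg
  obtain ⟨c, rfl⟩ := hg
  have hc : c ≠ 0 := by
    rintro rfl
    simp at hf₀
  exact ((IsUnit.mk0 c hc).map (algebraMap K _)).mul_left_dvd.2 dvd_rfl

theorem exists_symMap_eq_mul_of_dvd {p : M →ₗ[K] N} (hp : Function.Surjective p) {d e : ℕ}
    {a b : SymmetricAlgebra K M} (ha : a ∈ LinearMap.range (ι K M) ^ d)
    (hb : b ∈ LinearMap.range (ι K M) ^ e) (h : symMap p b ∣ symMap p a) :
    ∃ f, symMap p a = symMap p (f * b) ∧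
      (f = 0 ∨ e ≤ d ∧ f ∈ LinearMap.range (ι K M) ^ (d - e)) := by
  rcases eq_or_ne (symMap p a) 0 with ha₀ | ha₀
  · exact ⟨0, by rw [ha₀, zero_mul, map_zero], Or.inl rfl⟩
  · obtain ⟨hle, g, hg, hag⟩ :=
      exists_eq_mul_of_dvd_of_mem (symMap_mem p hb) (symMap_mem p ha) h ha₀
    obtain ⟨f, hf, rfl⟩ := exists_mem_symMap_eq hp hg
    exact ⟨f, by rw [hag, map_mul], Or.inr ⟨hle, hf⟩⟩

end HomogeneousDivision

section Addition

variable {K : Type*} [Field K] {V : Type*} [AddCommGroup V] [Module K V]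

local notation "Sym" => SymmetricAlgebra K (Module.Dual K V)
local notation "Der" => Derivation K Sym Sym

theorem IsHomogeneousBasis.exists_shear {D : Submodule Sym Der} {H₀ : Submodule K V}
    (h₀ : IsCoatom H₀) {κ : Type*} {θ : κ → Der} {d : κ → ℕ} (hθ : IsHomogeneousBasis D θ d)
    (l : κ) (hdvd : ∀ i, symRestrict H₀ (θ l (definingPolynomial H₀)) ∣
      symRestrict H₀ (θ i (definingPolynomial H₀))) :
    ∃ ψ, IsHomogeneousBasis D ψ d ∧ ψ l = θ l ∧
      ∀ i ≠ l, definingPolynomial H₀ ∣ ψ i (definingPolynomial H₀) := by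
  classical
  choose f hf hfdeg using fun i => exists_symMap_eq_mul_of_dvd Subspace.dualRestrict_surjective
    (hθ.homogeneous i _) (hθ.homogeneous l _) (hdvd i)
  have hfhom (i) : IsHomogeneousDerivation (f i • θ l) (d i) := by
    rcases hfdeg i with h | ⟨hle, h⟩
    · rw [h, zero_smul]
      exact isHomogeneousDerivation_zero _
    · have hsmul := (hθ.homogeneous l).smul h
      rwa [Nat.sub_add_cancel hle] at hsmul
  refine ⟨_, hθ.sub_smul (Function.update_self l 0 f) fun i => ?_, ?_, fun i hi => ?_⟩
  · rcases eq_or_ne i l with rfl | hi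
    · rw [Function.update_self, zero_smul]
      exact isHomogeneousDerivation_zero _
    · rw [Function.update_of_ne hi]
      exact hfhom i
  · rw [Function.update_self, zero_smul, sub_zero]
  · rw [← symRestrict_eq_zero_iff h₀, Function.update_of_ne hi, Derivation.sub_apply, map_sub,
      Derivation.smul_apply, smul_eq_mul, hf i, sub_self]

theorem dvd_coeff_of_dvd_sum_smul_apply {κ : Type*} [Fintype κ] {θ : κ → Der} {a b : Sym}
    (ha : Prime a) {l : κ} (hdvd : ∀ i ≠ l, a ∣ θ i b) (hl : ¬ a ∣ θ l b) {g : κ → Sym}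
    (hg : a ∣ (∑ i, g i • θ i) b) : a ∣ g l := by
  classical
  rw [derivation_sum_smul_apply, ← Finset.add_sum_erase _ _ (Finset.mem_univ l),
    dvd_add_left (Finset.dvd_sum fun i hi =>
      (hdvd i (Finset.ne_of_mem_erase hi)).mul_left _)] at hg
  exact (ha.dvd_or_dvd hg).resolve_right hl

theorem IsHomogeneousBasis.update_smul {A : HyperplaneArrangement K V} {H₀ : Submodule K V}
    (h₀ : H₀ ∈ A.hyperplanes) {κ : Type*} [Finite κ] [DecidableEq κ] {θ : κ → Der} {d : κ → ℕ}
    (hθ : IsHomogeneousBasis (A.deletion H₀).derivationModule θ d) {l : κ}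
    (hdvd : ∀ i ≠ l, definingPolynomial H₀ ∣ θ i (definingPolynomial H₀))
    (hl : ¬ definingPolynomial H₀ ∣ θ l (definingPolynomial H₀)) :
    IsHomogeneousBasis A.derivationModule
      (Function.update θ l (definingPolynomial H₀ • θ l)) (Function.update d l (1 + d l)) := by
  cases nonempty_fintype κ
  have hprime := prime_definingPolynomial (A.isCoatom H₀ h₀)
  refine ⟨?_, le_antisymm (Submodule.span_le.2 ?_) fun η hη => ?_, fun i => ?_⟩
  · refine hθ.linearIndependent.update l _
      ⟨1, one_mem _, Finsupp.single l (definingPolynomial H₀), ?_, ?_⟩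
    · rw [Finsupp.single_eq_same]
      exact mem_nonZeroDivisors_of_ne_zero hprime.ne_zero
    · rw [Finsupp.linearCombination_single, one_smul]
  · rintro _ ⟨i, rfl⟩
    rw [SetLike.mem_coe, mem_derivationModule_iff_deletion h₀]
    rcases eq_or_ne i l with rfl | hi
    · rw [Function.update_self]
      exact ⟨Submodule.smul_mem _ _ (hθ.mem i), dvd_mul_right _ _⟩
    · rw [Function.update_of_ne hi]
      exact ⟨hθ.mem i, hdvd i hi⟩
  · obtain ⟨hη', hηα⟩ := (mem_derivationModule_iff_deletion h₀).1 hη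
    obtain ⟨g, rfl⟩ := hθ.exists_eq_sum hη'
    refine Submodule.sum_mem _ fun i _ => ?_
    have hi := Submodule.subset_span (R := Sym)
      (Set.mem_range_self (f := Function.update θ l (definingPolynomial H₀ • θ l)) i)
    rcases eq_or_ne i l with rfl | hil
    · obtain ⟨r, hr⟩ := dvd_coeff_of_dvd_sum_smul_apply hprime hdvd hl hηα
      rw [Function.update_self] at hi
      rw [hr, mul_comm, mul_smul]
      exact Submodule.smul_mem _ _ hi
    · rw [Function.update_of_ne hil] at hi
      exact Submodule.smul_mem _ _ hi
  · rcases eq_or_ne i l with rfl | hi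
    · rw [Function.update_self, Function.update_self]
      refine (hθ.homogeneous i).smul ?_
      rw [pow_one]
      exact LinearMap.mem_range_self _ _
    · rw [Function.update_of_ne hi, Function.update_of_ne hi]
      exact hθ.homogeneous i

theorem IsHomogeneousBasis.exists_degree_eq_not_dvd {A : HyperplaneArrangement K V}
    {H₀ : Submodule K V} (h₀ : H₀ ∈ A.hyperplanes) {κ : Type*} [Fintype κ] {θ : κ → Der}
    {d : κ → ℕ} (hθ : IsHomogeneousBasis (A.deletion H₀).derivationModule θ d)
    {E : Multiset ℕ} {m : ℕ} (hE : (A.restriction H₀).IsFreeWithExponents E)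
    (hd : m ::ₘ E = Finset.univ.val.map d) {q : SymmetricAlgebra K (Module.Dual K H₀)}
    (hq : q ∈ LinearMap.range (ι K (Module.Dual K H₀)) ^ m)
    (hdvd : ∀ i, q ∣ symRestrict H₀ (θ i (definingPolynomial H₀))) :
    ∃ l, d l = m ∧ ¬ definingPolynomial H₀ ∣ θ l (definingPolynomial H₀) := by
  -- Otherwise all `θ i` of degree at most `m` lie in `D(A)`, so their restrictions are independent
  -- elements of `D(A'')`, which has only `exp A'' = exp A' - {m}` to offer in these degrees.
  by_contra! hcon
  have hmem (i) (hi : d i < m + 1) : θ i ∈ A.derivationModule := by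
    refine (mem_derivationModule_iff_deletion h₀).2 ⟨hθ.mem i, ?_⟩
    by_contra hndvd
    have hle := (exists_eq_mul_of_dvd_of_mem hq (symMap_mem _ (hθ.homogeneous i _)) (hdvd i)
      (mt (symRestrict_eq_zero_iff (A.isCoatom H₀ h₀) _).1 hndvd)).1
    exact hndvd (hcon i (by lia))
  have hcard := hθ.card_degree_lt_le_countP h₀ hmem hE
  rw [← countP_map_univ d (· < m + 1), ← hd,
    Multiset.countP_cons_of_pos (p := (· < m + 1)) _ m.lt_succ_self] at hcard
  lia

theorem map_univ_update {κ : Type*} [Fintype κ] [DecidableEq κ] {d : κ → ℕ} {l : κ}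
    {E : Multiset ℕ} (h : d l ::ₘ E = Finset.univ.val.map d) (k : ℕ) :
    Finset.univ.val.map (Function.update d l k) = k ::ₘ E := by
  have huniv : (Finset.univ : Finset κ).val = l ::ₘ (Finset.univ.erase l).val := by
    rw [Finset.erase_val, Multiset.cons_erase (Finset.mem_univ_val l)]
  rw [huniv, Multiset.map_cons, Multiset.cons_inj_right] at h
  rw [huniv, Multiset.map_cons, Function.update_self, h]
  congr 1
  exact Multiset.map_congr rfl fun i hi => Function.update_of_ne (Finset.ne_of_mem_erase hi) _ _

theorem IsFreeWithExponents.addition {A : HyperplaneArrangement K V} {H₀ : Submodule K V}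
    (h₀ : H₀ ∈ A.hyperplanes) {E : Multiset ℕ} {m : ℕ}
    (hE : (A.restriction H₀).IsFreeWithExponents E)
    (hE' : (A.deletion H₀).IsFreeWithExponents (m ::ₘ E))
    {q : SymmetricAlgebra K (Module.Dual K H₀)}
    (hq : q ∈ LinearMap.range (ι K (Module.Dual K H₀)) ^ m)
    (hdvd : ∀ θ ∈ (A.deletion H₀).derivationModule,
      q ∣ symRestrict H₀ (θ (definingPolynomial H₀))) :
    A.IsFreeWithExponents ((1 + m) ::ₘ E) := by
  obtain ⟨n, θ, d, hθ, hd⟩ := hE'.exists_isHomogeneousBasis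
  obtain ⟨l, rfl, hl⟩ := hθ.exists_degree_eq_not_dvd h₀ hE hd hq fun i => hdvd _ (hθ.mem i)
  have h₀' := A.isCoatom H₀ h₀
  have hlq : symRestrict H₀ (θ l (definingPolynomial H₀)) ∣ q :=
    dvd_of_dvd_of_mem_pow hq (symMap_mem _ (hθ.homogeneous l _)) (hdvd _ (hθ.mem l))
      (mt (symRestrict_eq_zero_iff h₀' _).1 hl)
  obtain ⟨ψ, hψ, hψl, hψdvd⟩ :=
    hθ.exists_shear h₀' l fun i => hlq.trans (hdvd _ (hθ.mem i))
  rw [← map_univ_update hd]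
  exact (hψ.update_smul h₀ hψdvd (hψl ▸ hl)).isFreeWithExponents

end Addition

theorem ι_dvd_wronskian {K : Type*} [Field K] {M : Type*} [AddCommGroup M] [Module K M]
    {θ : Derivation K (SymmetricAlgebra K M) (SymmetricAlgebra K M)} {a b e : M} {c t : K}
    (ha : a = c • e + t • b) (h : ι K M e ∣ θ (ι K M e)) :
    ι K M e ∣ θ (ι K M a) * ι K M b - ι K M a * θ (ι K M b) := by
  obtain ⟨f, hf⟩ := h
  refine ⟨c • (f * ι K M b - θ (ι K M b)), ?_⟩
  simp only [ha, map_add, map_smul, Derivation.map_smul, hf]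
  simp only [Algebra.smul_def]
  ring

section Divisibility

variable {K : Type*} [Field K] {V : Type*} [AddCommGroup V] [Module K V]

local notation "Sym" => SymmetricAlgebra K (Module.Dual K V)
local notation "Der" => Derivation K Sym Sym

theorem not_le_of_mem_deletion {A : HyperplaneArrangement K V} {H₀ H : Submodule K V}
    (h₀ : IsCoatom H₀) (hH : H ∈ (A.deletion H₀).hyperplanes) : ¬ H₀ ≤ H :=
  fun hle => (h₀.le_iff.1 hle).elim (A.isCoatom H hH.1).ne_top hH.2

theorem dualRestrict_definingForm_ne_zero {H X : Submodule K V} (hH : IsCoatom H)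
    (hX : ¬ X ≤ H) : X.dualRestrict (definingForm H) ≠ 0 := by
  intro h
  refine (isCoatom_interIn hH hX).ne_top ?_
  rw [← ker_dualRestrict_definingForm hH, h, LinearMap.ker_zero]

theorem exists_definingForm_eq_add_of_interIn_le {H₀ H X : Submodule K V} (h₀ : IsCoatom H₀)
    (hH : IsCoatom H) (hX : IsCoatom X) (h : interIn H₀ H ≤ interIn H₀ X) :
    ∃ c t : K, definingForm X = c • definingForm H + t • definingForm H₀ := by
  rw [← ker_dualRestrict_definingForm hH, ← ker_dualRestrict_definingForm hX] at h
  obtain ⟨c, hc⟩ := exists_eq_smul_of_ker_le h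
  have hker : definingForm X - c • definingForm H ∈ LinearMap.ker H₀.dualRestrict := by
    rw [LinearMap.mem_ker, map_sub, map_smul, hc, sub_self]
  rw [ker_dualRestrict h₀, Submodule.mem_span_singleton] at hker
  obtain ⟨t, ht⟩ := hker
  exact ⟨c, t, by rw [ht, add_sub_cancel]⟩

theorem prod_symRestrict_dvd_of_interIn_eq {A : HyperplaneArrangement K V} {H₀ X : Submodule K V}
    (h₀ : IsCoatom H₀) {θ : Der} (hθ : θ ∈ (A.deletion H₀).derivationModule)
    (hX : X ∈ (A.deletion H₀).hyperplanes) {F : Finset (Submodule K V)}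
    (hF : ∀ H ∈ F, H ∈ (A.deletion H₀).hyperplanes) (hXF : X ∉ F)
    (hint : ∀ H ∈ F, interIn H₀ H = interIn H₀ X) :
    ∏ H ∈ F, symRestrict H₀ (definingPolynomial H) ∣
      symRestrict H₀ (θ (definingPolynomial H₀)) := by
  classical
  have hF' : ∀ H ∈ insert X F, H ∈ (A.deletion H₀).hyperplanes :=
    Finset.forall_mem_insert _ _ _ |>.2 ⟨hX, hF⟩
  have hcoatom (H) (hH : H ∈ insert X F) : IsCoatom H := A.isCoatom H (hF' H hH).1
  -- Each such `α_H` lies in the pencil spanned by `α_{H₀}` and `α_X`, so it divides the Wronskian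
  -- of the two. On `H₀`, where `α_{H₀}` vanishes, the factor `α_X` of the Wronskian cancels.
  have hdvd : ∏ H ∈ insert X F, definingPolynomial H ∣
      θ (definingPolynomial X) * definingPolynomial H₀ -
        definingPolynomial X * θ (definingPolynomial H₀) := by
    refine Finset.prod_dvd_of_isRelPrime (fun H hH H' hH' hne => ?_) fun H hH => ?_
    · refine isRelPrime_ι (definingForm_ne_zero (hcoatom H hH))
        (definingForm_ne_zero (hcoatom H' hH')) ?_
      rwa [ker_definingForm (hcoatom H hH), ker_definingForm (hcoatom H' hH')]
    · have hinter : interIn H₀ H = interIn H₀ X :=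
        (Finset.mem_insert.1 hH).elim (fun h => h ▸ rfl) (hint H)
      obtain ⟨c, t, hXH⟩ := exists_definingForm_eq_add_of_interIn_le h₀ (hcoatom H hH)
        (A.isCoatom X hX.1) hinter.le
      exact ι_dvd_wronskian hXH (mem_derivationModule_iff.1 hθ H (hF' H hH))
  have hrestrict := map_dvd (symRestrict H₀) hdvd
  have hX₀ : symRestrict H₀ (definingPolynomial X) ≠ 0 := fun h =>
    hX.2 (eq_of_definingPolynomial_dvd h₀ (A.isCoatom X hX.1)
      ((symRestrict_eq_zero_iff h₀ _).1 h)).symm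
  rwa [map_prod, Finset.prod_insert hXF, map_sub, map_mul, map_mul,
    (symRestrict_eq_zero_iff h₀ (definingPolynomial H₀)).2 dvd_rfl, mul_zero, zero_sub, dvd_neg,
    mul_dvd_mul_iff_left hX₀] at hrestrict

theorem prod_symRestrict_dvd {A : HyperplaneArrangement K V} {H₀ : Submodule K V}
    (h₀ : H₀ ∈ A.hyperplanes) {θ : Der} (hθ : θ ∈ (A.deletion H₀).derivationModule)
    {F : Finset (Submodule K V)} (hF : ∀ H ∈ F, H ∈ (A.deletion H₀).hyperplanes)
    (hsurj : Set.SurjOn (interIn H₀) ((A.deletion H₀).hyperplanes \ F)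
      (A.restriction H₀).hyperplanes) :
    ∏ H ∈ F, symRestrict H₀ (definingPolynomial H) ∣
      symRestrict H₀ (θ (definingPolynomial H₀)) := by
  classical
  have h₀' := A.isCoatom H₀ h₀
  have hle (H) (hH : H ∈ F) : ¬ H₀ ≤ H := not_le_of_mem_deletion h₀' (hF H hH)
  have hcoatom (H) (hH : H ∈ F) : IsCoatom H := A.isCoatom H (hF H hH).1
  rw [← Finset.prod_fiberwise_of_maps_to fun H hH => Finset.mem_image_of_mem (interIn H₀) hH]
  refine Finset.prod_dvd_of_isRelPrime (fun Y _ Z _ hYZ => ?_) fun Y hY => ?_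
  · refine IsRelPrime.prod_left fun H hH => IsRelPrime.prod_right fun H' hH' => ?_
    rw [Finset.mem_filter] at hH hH'
    rw [symMap_ι, symMap_ι]
    refine isRelPrime_ι (dualRestrict_definingForm_ne_zero (hcoatom H hH.1) (hle H hH.1))
      (dualRestrict_definingForm_ne_zero (hcoatom H' hH'.1) (hle H' hH'.1)) ?_
    rwa [ker_dualRestrict_definingForm (hcoatom H hH.1),
      ker_dualRestrict_definingForm (hcoatom H' hH'.1), hH.2, hH'.2]
  · obtain ⟨H, hH, rfl⟩ := Finset.mem_image.1 hY
    obtain ⟨X, ⟨hX, hXF⟩, hXH⟩ := hsurj ⟨H, ⟨(hF H hH).1, hle H hH⟩, rfl⟩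
    exact prod_symRestrict_dvd_of_interIn_eq h₀' hθ hX
      (fun H' hH' => hF H' (Finset.mem_filter.1 hH').1)
      (fun hX' => hXF (Finset.mem_filter.1 hX').1)
      fun H' hH' => (Finset.mem_filter.1 hH').2.trans hXH.symm

end Divisibility

/-- The cardinalities of the blocks of `π`, with multiplicity. Empty blocks are left out, so that
removing the only element of a block has the same effect as removing the block. -/
noncomputable def blockSizes {X : Type*} (π : Set (Set X)) : Multiset ℕ :=
  ∑ᶠ B ∈ π, ({B.ncard} : Multiset ℕ).filter (· ≠ 0)

theorem blockSizes_insert {X : Type*} {π : Set (Set X)} (hπ : π.Finite) {B : Set X} (hB : B ∉ π) :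
    blockSizes (insert B π) = ({B.ncard} : Multiset ℕ).filter (· ≠ 0) + blockSizes π :=
  finsum_mem_insert _ hB hπ

theorem blockSizes_union {X : Type*} {π ρ : Set (Set X)} (h : Disjoint π ρ) (hπ : π.Finite)
    (hρ : ρ.Finite) : blockSizes (π ∪ ρ) = blockSizes π + blockSizes ρ :=
  finsum_mem_union h hπ hρ

theorem blockSizes_image {X Y : Type*} {π : Set (Set X)} {φ : Set X → Set Y} (hφ : π.InjOn φ)
    (hcard : ∀ B ∈ π, (φ B).ncard = B.ncard) : blockSizes (φ '' π) = blockSizes π := by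
  rw [blockSizes, finsum_mem_image hφ, blockSizes]
  exact finsum_mem_congr rfl fun B hB => by rw [hcard B hB]

theorem blockSizes_setOf_nonempty_and_mem {X : Type*} (π : Set (Set X)) :
    blockSizes {C | C.Nonempty ∧ C ∈ π} = blockSizes π := by
  refine finsum_mem_inter_support_eq _ _ _ (Set.ext fun C => ⟨fun h => ⟨h.1.2, h.2⟩, fun h => ?_⟩)
  refine ⟨⟨Set.nonempty_of_ncard_ne_zero fun h0 => h.2 ?_, h.1⟩, h.2⟩
  simp only [h0]
  rfl

theorem eq_of_card_eq_of_filter_ne_zero_eq {E F : Multiset ℕ} (hcard : E.card = F.card)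
    (h : E.filter (· ≠ 0) = F.filter (· ≠ 0)) : E = F := by
  have hE := Multiset.filter_add_not (· = 0) E
  have hF := Multiset.filter_add_not (· = 0) F
  rw [Multiset.filter_eq'] at hE hF
  have hcount : E.count 0 = F.count 0 := by
    rw [← hE, ← hF] at hcard
    simp only [Multiset.card_add, Multiset.card_replicate] at hcard
    have := congrArg Multiset.card h
    simp only [ne_eq] at this
    lia
  rw [← hE, ← hF, hcount]
  exact congrArg _ h

section Exponents

variable {K : Type*} [Field K] {V : Type*} [AddCommGroup V] [Module K V]
  {A : HyperplaneArrangement K V} {π : Set (Set (Submodule K V))} {B B₁ : Set (Submodule K V)}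
  {H₀ : Submodule K V}

theorem IsPartition.subset (hπ : A.IsPartition π) (hB : B ∈ π) : B ⊆ A.hyperplanes :=
  hπ.sUnion ▸ Set.subset_sUnion_of_mem hB

theorem IsPartition.finite (hπ : A.IsPartition π) : π.Finite :=
  A.finite.finite_subsets.subset fun _ hB => hπ.subset hB

theorem IsPartition.eq_of_mem_of_mem (hπ : A.IsPartition π) (hB : B ∈ π) (hB₁ : B₁ ∈ π)
    {H : Submodule K V} (hH : H ∈ B) (hH₁ : H ∈ B₁) : B = B₁ :=
  hπ.disjoint.elim hB hB₁ (Set.not_disjoint_iff.2 ⟨H, hH, hH₁⟩)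

theorem IsPartition.subset_sdiff (hπ : A.IsPartition π) (hB₁ : B₁ ∈ π) (hB : B ∈ π \ {B₁}) :
    B ⊆ A.hyperplanes \ B₁ :=
  fun _ hH => ⟨hπ.subset hB.1 hH, fun hH₁ => hB.2 (hπ.eq_of_mem_of_mem hB.1 hB₁ hH hH₁)⟩

theorem IsPartition.sdiff_singleton_notMem (hπ : A.IsPartition π) (hB₁ : B₁ ∈ π) :
    B₁ \ {H₀} ∉ π \ {B₁} := fun hmem =>
  have ⟨_, hH⟩ := hπ.nonempty _ hmem.1
  (hπ.subset_sdiff hB₁ hmem hH).2 hH.1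

theorem deletionPartition_eq (hπ : A.IsPartition π) (hB₁ : B₁ ∈ π) (hH₀ : H₀ ∈ B₁) :
    A.deletionPartition π H₀ = {C | C.Nonempty ∧ C ∈ insert (B₁ \ {H₀}) (π \ {B₁})} := by
  have hinter (B : Set (Submodule K V)) (hB : B ∈ π) :
      B ∩ (A.deletion H₀).hyperplanes = B \ {H₀} := by
    rw [deletion, ← Set.inter_sdiff_assoc, Set.inter_eq_left.2 (hπ.subset hB)]
  have hother (B : Set (Submodule K V)) (hB : B ∈ π \ {B₁}) : B \ {H₀} = B :=
    Set.sdiff_singleton_eq_self fun hmem => (hπ.subset_sdiff hB₁ hB hmem).2 hH₀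
  ext C
  refine and_congr_right fun _ => ⟨?_, ?_⟩
  · rintro ⟨B, hB, rfl⟩
    rw [hinter B hB]
    by_cases hBB₁ : B = B₁
    · exact Or.inl (by rw [hBB₁])
    · rw [hother B ⟨hB, hBB₁⟩]
      exact Or.inr ⟨hB, hBB₁⟩
  · rintro (rfl | hC)
    · exact ⟨B₁, hB₁, (hinter B₁ hB₁).symm⟩
    · exact ⟨C, hC.1, by rw [hinter C hC.1, hother C hC]⟩

theorem IsPartition.blockSizes_deletionPartition (hπ : A.IsPartition π) (hB₁ : B₁ ∈ π)
    (hH₀ : H₀ ∈ B₁) : blockSizes (A.deletionPartition π H₀) =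
      ({(B₁ \ {H₀}).ncard} : Multiset ℕ).filter (· ≠ 0) + blockSizes (π \ {B₁}) := by
  rw [deletionPartition_eq hπ hB₁ hH₀, blockSizes_setOf_nonempty_and_mem,
    blockSizes_insert hπ.finite.sdiff (hπ.sdiff_singleton_notMem hB₁)]

theorem IsPartition.blockSizes_restrictionPartition (hπ : A.IsPartition π) (hB₁ : B₁ ∈ π)
    (hinj : Set.InjOn (interIn H₀) (A.hyperplanes \ B₁)) :
    blockSizes (restrictionPartition π B₁ H₀) = blockSizes (π \ {B₁}) := by
  refine blockSizes_image (fun B hB C hC => ?_) fun B hB => ?_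
  · exact (hinj.image_eq_image_iff (hπ.subset_sdiff hB₁ hB) (hπ.subset_sdiff hB₁ hC)).1
  · exact (hinj.mono (hπ.subset_sdiff hB₁ hB)).ncard_image

theorem blockSizes_eq_add_sdiff (hπ : π.Finite) (hB₁ : B₁ ∈ π) :
    blockSizes π = ({B₁.ncard} : Multiset ℕ).filter (· ≠ 0) + blockSizes (π \ {B₁}) := by
  have hnotMem : B₁ ∉ π \ {B₁} := fun h => h.2 rfl
  rw [← blockSizes_insert hπ.sdiff hnotMem, Set.insert_sdiff_self_of_mem hB₁]

theorem finrank_add_one_of_isCoatom [FiniteDimensional K V] (h₀ : IsCoatom H₀) :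
    Module.finrank K H₀ + 1 = Module.finrank K V := by
  have := Module.Dual.finrank_ker_add_one_of_ne_zero (definingForm_ne_zero h₀)
  rwa [ker_definingForm h₀] at this

theorem IsFreeWithExponents.addition_of_surjOn [FiniteDimensional K V]
    (hB₁ : B₁ ⊆ A.hyperplanes) (hH₀ : H₀ ∈ B₁)
    (hsurj : Set.SurjOn (interIn H₀) (A.hyperplanes \ B₁) (A.restriction H₀).hyperplanes)
    {E : Multiset ℕ} (hE : (A.restriction H₀).IsFreeWithExponents E)
    (hE' : (A.deletion H₀).IsFreeWithExponents ((B₁ \ {H₀}).ncard ::ₘ E)) :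
    A.IsFreeWithExponents (B₁.ncard ::ₘ E) := by
  have hfin : (B₁ \ {H₀}).Finite := (A.finite.subset hB₁).sdiff
  have hF : ∀ H ∈ hfin.toFinset, H ∈ (A.deletion H₀).hyperplanes := fun H hH =>
    have hH := hfin.mem_toFinset.1 hH
    ⟨hB₁ hH.1, hH.2⟩
  have hsurj' : Set.SurjOn (interIn H₀) ((A.deletion H₀).hyperplanes \ hfin.toFinset)
      (A.restriction H₀).hyperplanes := by
    refine hsurj.mono (fun H hH => ⟨⟨hH.1, ?_⟩, ?_⟩) subset_rfl
    · rintro rfl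
      exact hH.2 hH₀
    · rw [hfin.coe_toFinset]
      exact fun hmem => hH.2 hmem.1
  have hdeg : ∏ H ∈ hfin.toFinset, symRestrict H₀ (definingPolynomial H) ∈
      LinearMap.range (ι K (Module.Dual K H₀)) ^ (B₁ \ {H₀}).ncard := by
    rw [Set.ncard_eq_toFinset_card _ hfin]
    simp only [symMap_ι]
    exact prod_ι_mem_pow_card _ _
  rw [← Set.ncard_sdiff_singleton_add_one hH₀ (A.finite.subset hB₁), add_comm]
  exact hE.addition (hB₁ hH₀) hE' hdeg fun θ hθ => prod_symRestrict_dvd (hB₁ hH₀) hθ hF hsurj'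

end Exponents

theorem IsInductiveFactorization.exists_isFreeWithExponents {K : Type*} [Field K] {V : Type*}
    [AddCommGroup V] [Module K V] {A : HyperplaneArrangement K V}
    {π : Set (Set (Submodule K V))} (h : IsInductiveFactorization A π) :
    ∀ [FiniteDimensional K V], ∃ E : Multiset ℕ, A.IsFreeWithExponents E ∧
      E.card = Module.finrank K V ∧ E.filter (· ≠ 0) = blockSizes π := by
  induction h with
  | empty V =>
    intro _
    refine ⟨_, isFreeWithExponents_empty, Multiset.card_replicate _ _, ?_⟩
    rw [blockSizes, finsum_mem_empty]
    exact Multiset.filter_eq_nil.2 fun k hk => not_not.2 (Multiset.eq_of_mem_replicate hk)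
  | @addition V _ _ A π hπ B₁ hB₁ H₀ hH₀ bij _ _ ih' ih'' =>
    intro _
    have hrank := finrank_add_one_of_isCoatom (A.isCoatom H₀ (hπ.subset hB₁ hH₀))
    obtain ⟨E', hE', hcard', hblocks'⟩ := ih'
    obtain ⟨E, hE, hcard, hblocks⟩ := ih''
    rw [hπ.blockSizes_restrictionPartition hB₁ bij.injOn] at hblocks
    rw [hπ.blockSizes_deletionPartition hB₁ hH₀, ← hblocks, ← Multiset.filter_add,
      Multiset.singleton_add] at hblocks'
    have hE'E : E' = (B₁ \ {H₀}).ncard ::ₘ E :=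
      eq_of_card_eq_of_filter_ne_zero_eq (by rw [Multiset.card_cons, hcard', hcard, hrank]) hblocks'
    refine ⟨_, hE.addition_of_surjOn (hπ.subset hB₁) hH₀ bij.surjOn (hE'E ▸ hE'), ?_, ?_⟩
    · rw [Multiset.card_cons, hcard, hrank]
    · rw [blockSizes_eq_add_sdiff hπ.finite hB₁, ← hblocks, ← Multiset.filter_add,
        Multiset.singleton_add]

section NonemptyImages

variable {X Y Z : Type*}

/-- The non-empty sets among the images `φ B` of the members `B` of a family `π` of sets. Both the
induced partition of a deletion and that of a factor of a product are of this form. -/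
def nonemptyImages (φ : Set X → Set Y) (π : Set (Set X)) : Set (Set Y) :=
  {C | C.Nonempty ∧ ∃ B ∈ π, C = φ B}

theorem nonemptyImages_congr {φ ψ : Set X → Set Y} {π : Set (Set X)}
    (h : ∀ B ∈ π, φ B = ψ B) : nonemptyImages φ π = nonemptyImages ψ π := by
  ext C
  exact and_congr_right fun _ => exists_congr fun B => and_congr_right fun hB => by rw [h B hB]

theorem nonemptyImages_nonemptyImages {φ : Set Y → Set Z} (hφ : φ ∅ = ∅) (ψ : Set X → Set Y)
    (π : Set (Set X)) :
    nonemptyImages φ (nonemptyImages ψ π) = nonemptyImages (φ ∘ ψ) π := by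
  ext C
  refine and_congr_right fun hC => ⟨?_, ?_⟩
  · rintro ⟨_, ⟨_, B, hB, rfl⟩, rfl⟩
    exact ⟨B, hB, rfl⟩
  · rintro ⟨B, hB, rfl⟩
    refine ⟨ψ B, ⟨Set.nonempty_iff_ne_empty.2 fun hψ => hC.ne_empty ?_, B, hB, rfl⟩, rfl⟩
    rw [Function.comp_apply, hψ, hφ]

theorem nonemptyImages_image (φ : Set Y → Set Z) (ψ : Set X → Set Y) (π : Set (Set X)) :
    nonemptyImages φ (ψ '' π) = nonemptyImages (φ ∘ ψ) π := by
  ext C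
  simp only [nonemptyImages, Set.exists_mem_image, Function.comp_apply]

theorem image_nonemptyImages (ψ : Y → Z) (φ : Set X → Set Y) (π : Set (Set X)) :
    (ψ '' ·) '' nonemptyImages φ π = nonemptyImages (fun B => ψ '' φ B) π := by
  ext C
  constructor
  · rintro ⟨_, ⟨hne, B, hB, rfl⟩, rfl⟩
    exact ⟨hne.image ψ, B, hB, rfl⟩
  · rintro ⟨hne, B, hB, rfl⟩
    exact ⟨_, ⟨Set.image_nonempty.1 hne, B, hB, rfl⟩, rfl⟩

end NonemptyImages

section JointPullback

variable {K : Type*} [Field K] {U : Type*} [AddCommGroup U] [Module K U]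
  {V : Type*} [AddCommGroup V] [Module K V] {W : Type*} [AddCommGroup W] [Module K W]
  {f : U →ₗ[K] V} {g : U →ₗ[K] W} {A : HyperplaneArrangement K U}
  {A₁ : HyperplaneArrangement K V} {A₂ : HyperplaneArrangement K W}

/-- `A` consists of the preimages of the hyperplanes of `A₁` and of `A₂` under the two components
of a surjective linear map `(f, g)`. Unlike product arrangements, this class is closed under
restriction to a hyperplane, since `H₁ ⊕ W` is not of the form `V ⊕ W`. -/
structure IsJointPullback (f : U →ₗ[K] V) (g : U →ₗ[K] W) (A : HyperplaneArrangement K U)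
    (A₁ : HyperplaneArrangement K V) (A₂ : HyperplaneArrangement K W) : Prop where
  surjective : Function.Surjective (f.prod g)
  hyperplanes_eq :
    A.hyperplanes = Submodule.comap f '' A₁.hyperplanes ∪ Submodule.comap g '' A₂.hyperplanes

theorem isJointPullback_prod (A₁ : HyperplaneArrangement K V) (A₂ : HyperplaneArrangement K W) :
    IsJointPullback (LinearMap.fst K V W) (LinearMap.snd K V W) (A₁.prod A₂) A₁ A₂ where
  surjective p := ⟨p, rfl⟩
  hyperplanes_eq := congrArg₂ (· ∪ ·) (Set.image_congr fun H _ => H.comap_fst.symm)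
    (Set.image_congr fun G _ => G.comap_snd.symm)

theorem IsJointPullback.symm (hA : IsJointPullback f g A A₁ A₂) : IsJointPullback g f A A₂ A₁ where
  surjective := Prod.swap_surjective.comp hA.surjective
  hyperplanes_eq := hA.hyperplanes_eq.trans (Set.union_comm _ _)

theorem IsJointPullback.comap_injective (hA : IsJointPullback f g A A₁ A₂) :
    Function.Injective (Submodule.comap f) :=
  Submodule.comap_injective_of_surjective (Prod.fst_surjective.comp hA.surjective)

theorem IsJointPullback.comap_ne_comap (hA : IsJointPullback f g A A₁ A₂) {H : Submodule K V}
    (hH : H ≠ ⊤) (G : Submodule K W) : H.comap f ≠ G.comap g := by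
  obtain ⟨v, -, hv⟩ := SetLike.exists_of_lt hH.lt_top
  obtain ⟨u, hu⟩ := hA.surjective (v, 0)
  obtain ⟨rfl, hgu⟩ := Prod.mk.inj hu
  intro heq
  have hmem : u ∈ H.comap f := by
    rw [heq, Submodule.mem_comap, hgu]
    exact G.zero_mem
  exact hv hmem

theorem IsJointPullback.comap_mem_iff (hA : IsJointPullback f g A A₁ A₂) {H : Submodule K V} :
    H.comap f ∈ A.hyperplanes ↔ H ∈ A₁.hyperplanes := by
  refine ⟨fun hH => ?_, fun hH => hA.hyperplanes_eq ▸ Or.inl ⟨H, hH, rfl⟩⟩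
  have hne : H ≠ ⊤ := by
    rintro rfl
    exact (A.isCoatom _ hH).ne_top (Submodule.comap_top f)
  rw [hA.hyperplanes_eq] at hH
  rcases hH with ⟨H', hH', heq⟩ | ⟨G, -, heq⟩
  · exact hA.comap_injective heq ▸ hH'
  · exact absurd heq.symm (hA.comap_ne_comap hne G)

theorem IsJointPullback.preimage_hyperplanes (hA : IsJointPullback f g A A₁ A₂) :
    Submodule.comap f ⁻¹' A.hyperplanes = A₁.hyperplanes :=
  Set.ext fun _ => hA.comap_mem_iff

theorem IsJointPullback.disjoint_image_comap (hA : IsJointPullback f g A A₁ A₂)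
    {B : Set (Submodule K V)} (hB : B ⊆ A₁.hyperplanes) (C : Set (Submodule K W)) :
    Disjoint (Submodule.comap f '' B) (Submodule.comap g '' C) := by
  refine Set.disjoint_left.2 ?_
  rintro _ ⟨H, hH, rfl⟩ ⟨G, -, hG⟩
  exact hA.comap_ne_comap (A₁.isCoatom _ (hB hH)).ne_top G hG.symm

theorem IsJointPullback.sdiff_image_comap (hA : IsJointPullback f g A A₁ A₂)
    {B : Set (Submodule K V)} (hB : B ⊆ A₁.hyperplanes) :
    A.hyperplanes \ Submodule.comap f '' B =
      Submodule.comap f '' (A₁.hyperplanes \ B) ∪ Submodule.comap g '' A₂.hyperplanes := by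
  rw [hA.hyperplanes_eq, Set.union_sdiff_distrib, Set.image_sdiff hA.comap_injective,
    (hA.disjoint_image_comap hB A₂.hyperplanes).symm.sdiff_eq_left]

theorem IsJointPullback.deletion (hA : IsJointPullback f g A A₁ A₂) {H₁ : Submodule K V}
    (hH₁ : H₁ ∈ A₁.hyperplanes) :
    IsJointPullback f g (A.deletion (H₁.comap f)) (A₁.deletion H₁) A₂ where
  surjective := hA.surjective
  hyperplanes_eq := by
    have := hA.sdiff_image_comap (Set.singleton_subset_iff.2 hH₁)
    rwa [Set.image_singleton] at this

/-- The map from the preimage of `H` to `H` induced by `f`. -/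
def comapRestrict (f : U →ₗ[K] V) (H : Submodule K V) : H.comap f →ₗ[K] H :=
  f.restrict fun _ h => h

theorem IsJointPullback.restriction (hA : IsJointPullback f g A A₁ A₂) {H₁ : Submodule K V}
    (hH₁ : H₁ ∈ A₁.hyperplanes) :
    IsJointPullback (comapRestrict f H₁) (g ∘ₗ (H₁.comap f).subtype)
      (A.restriction (H₁.comap f)) (A₁.restriction H₁) A₂ where
  surjective := by
    rintro ⟨v, w⟩
    obtain ⟨u, hu⟩ := hA.surjective (v.1, w)
    obtain ⟨hfu, hgu⟩ := Prod.mk.inj hu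
    exact ⟨⟨u, Submodule.mem_comap.2 (hfu ▸ v.2)⟩, Prod.ext (Subtype.ext hfu) hgu⟩
  hyperplanes_eq := by
    rw [A.restriction_hyperplanes (hA.comap_mem_iff.2 hH₁), (hA.deletion hH₁).hyperplanes_eq,
      A₁.restriction_hyperplanes hH₁]
    simp only [Set.image_union, Set.image_image]
    rfl

theorem IsJointPullback.bijOn_interIn_comap (hA : IsJointPullback f g A A₁ A₂)
    {B₁ : Set (Submodule K V)} (hB₁ : B₁ ⊆ A₁.hyperplanes) {H₁ : Submodule K V} (hH₁ : H₁ ∈ B₁)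
    (bij : Set.BijOn (interIn H₁) (A₁.hyperplanes \ B₁) (A₁.restriction H₁).hyperplanes) :
    Set.BijOn (interIn (H₁.comap f)) (A.hyperplanes \ Submodule.comap f '' B₁)
      (A.restriction (H₁.comap f)).hyperplanes := by
  have hA' := hA.restriction (hB₁ hH₁)
  have himage : (A.restriction (H₁.comap f)).hyperplanes = interIn (H₁.comap f) ''
      (Submodule.comap f '' (A₁.hyperplanes \ B₁) ∪ Submodule.comap g '' A₂.hyperplanes) := by
    rw [hA'.hyperplanes_eq, ← bij.image_eq]
    simp only [Set.image_union, Set.image_image]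
    rfl
  rw [hA.sdiff_image_comap hB₁, himage]
  refine Set.InjOn.bijOn_image ?_
  rw [Set.injOn_union (hA.disjoint_image_comap Set.sdiff_subset _)]
  refine ⟨?_, ?_, ?_⟩
  · rintro _ ⟨H, hH, rfl⟩ _ ⟨H', hH', rfl⟩ heq
    exact congrArg _ (bij.injOn hH hH' (hA'.comap_injective heq))
  · rintro _ ⟨G, -, rfl⟩ _ ⟨G', -, rfl⟩ heq
    exact congrArg _ (hA'.symm.comap_injective heq)
  · rintro _ ⟨H, hH, rfl⟩ _ ⟨G, -, rfl⟩
    exact hA'.comap_ne_comap ((A₁.restriction H₁).isCoatom _ (bij.mapsTo hH)).ne_top G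

theorem IsJointPullback.bijOn_interIn_preimage (hA : IsJointPullback f g A A₁ A₂)
    {B : Set (Submodule K U)} {H₁ : Submodule K V} (hH₁ : H₁ ∈ A₁.hyperplanes)
    (bij : Set.BijOn (interIn (H₁.comap f)) (A.hyperplanes \ B)
      (A.restriction (H₁.comap f)).hyperplanes) :
    Set.BijOn (interIn H₁) (A₁.hyperplanes \ Submodule.comap f ⁻¹' B)
      (A₁.restriction H₁).hyperplanes := by
  have hA' := hA.restriction hH₁
  rw [← hA.preimage_hyperplanes, ← hA'.preimage_hyperplanes]
  refine ⟨fun H hH => bij.mapsTo hH, fun H hH H' hH' heq => ?_, fun X hX => ?_⟩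
  · have hcomap := congrArg (Submodule.comap (comapRestrict f H₁)) heq
    exact hA.comap_injective (bij.injOn hH hH' hcomap)
  · obtain ⟨H, hH, hHX⟩ := bij.surjOn hX
    have hHA := hH.1
    rw [hA.hyperplanes_eq] at hHA
    rcases hHA with ⟨H', -, rfl⟩ | ⟨G, -, rfl⟩
    · exact ⟨H', hH, hA'.comap_injective hHX⟩
    · have hX' := (A₁.restriction H₁).isCoatom X (hA'.comap_mem_iff.1 hX)
      exact absurd hHX.symm (hA'.comap_ne_comap hX'.ne_top G)

end JointPullback

section InducedPartition

variable {K : Type*} [Field K] {U : Type*} [AddCommGroup U] [Module K U]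
  {V : Type*} [AddCommGroup V] [Module K V] {W : Type*} [AddCommGroup W] [Module K W]
  {f : U →ₗ[K] V} {g : U →ₗ[K] W} {A : HyperplaneArrangement K U}
  {A₁ : HyperplaneArrangement K V} {A₂ : HyperplaneArrangement K W}
  {π : Set (Set (Submodule K U))}

/-- The partition of the factor `A₁` of a joint pullback `A` induced by a partition `π` of `A`: a
hyperplane `H` of `A₁` is identified with its preimage under `f`. -/
def inducedPartition (f : U →ₗ[K] V) (π : Set (Set (Submodule K U))) :
    Set (Set (Submodule K V)) :=
  nonemptyImages (Submodule.comap f ⁻¹' ·) π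

theorem IsPartition.inducedPartition (hπ : A.IsPartition π) (hA : IsJointPullback f g A A₁ A₂) :
    A₁.IsPartition (inducedPartition f π) where
  nonempty _ hC := hC.1
  disjoint := by
    rintro _ ⟨_, B, hB, rfl⟩ _ ⟨_, C, hC, rfl⟩ hne
    exact (hπ.disjoint hB hC fun heq => hne (heq ▸ rfl)).preimage _
  sUnion := by
    rw [← hA.preimage_hyperplanes, ← hπ.sUnion]
    ext H
    constructor
    · rintro ⟨_, ⟨_, B, hB, rfl⟩, hH⟩
      exact ⟨B, hB, hH⟩
    · rintro ⟨B, hB, hH⟩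
      exact ⟨_, ⟨⟨H, hH⟩, B, hB, rfl⟩, hH⟩

theorem deletionPartition_inducedPartition (hA : IsJointPullback f g A A₁ A₂)
    {H₁ : Submodule K V} (hH₁ : H₁ ∈ A₁.hyperplanes) :
    A₁.deletionPartition (inducedPartition f π) H₁ =
      inducedPartition f (A.deletionPartition π (H₁.comap f)) := by
  refine (nonemptyImages_nonemptyImages (φ := (· ∩ (A₁.deletion H₁).hyperplanes))
    (Set.empty_inter _) _ _).trans ?_
  refine Eq.trans ?_ (nonemptyImages_nonemptyImages Set.preimage_empty _ _).symm
  refine nonemptyImages_congr fun B _ => ?_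
  simp only [Function.comp_apply, Set.preimage_inter, (hA.deletion hH₁).preimage_hyperplanes]

theorem inducedPartition_deletionPartition_comap (hA : IsJointPullback f g A A₁ A₂)
    (hπ : A.IsPartition π) {G : Submodule K W} (hG : G ∈ A₂.hyperplanes) :
    inducedPartition f (A.deletionPartition π (G.comap g)) = inducedPartition f π := by
  refine (nonemptyImages_nonemptyImages Set.preimage_empty _ _).trans ?_
  refine nonemptyImages_congr fun B hB => ?_
  rw [Function.comp_apply, Set.preimage_inter, (hA.symm.deletion hG).symm.preimage_hyperplanes,
    ← hA.preimage_hyperplanes, ← Set.preimage_inter, Set.inter_eq_left.2 (hπ.subset hB)]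

theorem interIn_image_preimage_comap (hA : IsJointPullback f g A A₁ A₂) {H₁ : Submodule K V}
    (hH₁ : H₁ ∈ A₁.hyperplanes) {B : Set (Submodule K U)}
    (hB : B ⊆ (A.deletion (H₁.comap f)).hyperplanes) :
    interIn H₁ '' (Submodule.comap f ⁻¹' B) =
      Submodule.comap (comapRestrict f H₁) ⁻¹' (interIn (H₁.comap f) '' B) := by
  have hA' := hA.restriction hH₁
  refine Set.Subset.antisymm ?_ fun X hX => ?_
  · rintro _ ⟨H, hH, rfl⟩
    exact ⟨_, hH, rfl⟩
  · obtain ⟨H, hH, hHX⟩ := hX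
    have hX : X ∈ (A₁.restriction H₁).hyperplanes := by
      rw [← hA'.comap_mem_iff, A.restriction_hyperplanes (hA.comap_mem_iff.2 hH₁), ← hHX]
      exact ⟨H, hB hH, rfl⟩
    have hHA := (hB hH).1
    rw [hA.hyperplanes_eq] at hHA
    rcases hHA with ⟨H', -, rfl⟩ | ⟨G, -, rfl⟩
    · exact ⟨H', hH, hA'.comap_injective hHX⟩
    · exact absurd hHX.symm (hA'.comap_ne_comap ((A₁.restriction H₁).isCoatom X hX).ne_top G)

theorem inducedPartition_sdiff_singleton (hπ : A.IsPartition π) {B₁ : Set (Submodule K U)}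
    (hB₁ : B₁ ∈ π) :
    inducedPartition f π \ {Submodule.comap f ⁻¹' B₁} = inducedPartition f (π \ {B₁}) := by
  ext C
  constructor
  · rintro ⟨⟨hC, B, hB, rfl⟩, hne⟩
    exact ⟨hC, B, ⟨hB, fun heq => hne (congrArg _ heq)⟩, rfl⟩
  · rintro ⟨⟨H, hH⟩, B, hB, rfl⟩
    refine ⟨⟨⟨H, hH⟩, B, hB.1, rfl⟩, fun heq => (hπ.subset_sdiff hB₁ hB hH).2 ?_⟩
    exact (Set.ext_iff.1 heq H).1 hH

theorem restrictionPartition_inducedPartition (hA : IsJointPullback f g A A₁ A₂)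
    (hπ : A.IsPartition π) {B₁ : Set (Submodule K U)} (hB₁ : B₁ ∈ π) {H₁ : Submodule K V}
    (hH₁ : H₁.comap f ∈ B₁) :
    restrictionPartition (inducedPartition f π) (Submodule.comap f ⁻¹' B₁) H₁ =
      inducedPartition (comapRestrict f H₁) (restrictionPartition π B₁ (H₁.comap f)) := by
  rw [restrictionPartition, inducedPartition_sdiff_singleton hπ hB₁, inducedPartition,
    image_nonemptyImages, restrictionPartition, inducedPartition, nonemptyImages_image]
  refine nonemptyImages_congr fun B hB => interIn_image_preimage_comap hA
    (hA.comap_mem_iff.1 (hπ.subset hB₁ hH₁)) fun H hH => ?_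
  have hHB := hπ.subset_sdiff hB₁ hB hH
  refine ⟨hHB.1, ?_⟩
  rintro rfl
  exact hHB.2 hH₁

end InducedPartition

theorem isInductiveFactorization_of_eq_empty {K : Type u} [Field K] {V : Type v}
    [AddCommGroup V] [Module K V] {A : HyperplaneArrangement K V} {π : Set (Set (Submodule K V))}
    (hA : A.hyperplanes = ∅) (hπ : π = ∅) : IsInductiveFactorization A π := by
  obtain rfl : A = empty K V := HyperplaneArrangement.ext hA
  exact hπ ▸ .empty V

theorem IsInductiveFactorization.inducedPartition {K : Type u} [Field K] {U : Type v}
    [AddCommGroup U] [Module K U] {A : HyperplaneArrangement K U} {π : Set (Set (Submodule K U))}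
    (hAπ : IsInductiveFactorization A π) :
    ∀ {V : Type w} [AddCommGroup V] [Module K V] {W : Type*} [AddCommGroup W] [Module K W]
      {f : U →ₗ[K] V} {g : U →ₗ[K] W} {A₁ : HyperplaneArrangement K V}
      {A₂ : HyperplaneArrangement K W}, IsJointPullback f g A A₁ A₂ →
      IsInductiveFactorization A₁ (inducedPartition f π) := by
  induction hAπ with
  | empty U =>
    intro V _ _ W _ _ f g A₁ A₂ hA
    refine isInductiveFactorization_of_eq_empty hA.preimage_hyperplanes.symm ?_
    exact Set.eq_empty_of_forall_notMem fun _ ⟨_, _, hB, _⟩ => hB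
  | @addition U _ _ A π hπ B₁ hB₁ H₀ hH₀ bij _ _ ih' ih'' =>
    intro V _ _ W _ _ f g A₁ A₂ hA
    have hH₀A := hπ.subset hB₁ hH₀
    rw [hA.hyperplanes_eq] at hH₀A
    rcases hH₀A with ⟨H₁, hH₁, rfl⟩ | ⟨G, hG, rfl⟩
    · refine .addition A₁ _ (hπ.inducedPartition hA) (Submodule.comap f ⁻¹' B₁)
        ⟨⟨H₁, hH₀⟩, B₁, hB₁, rfl⟩ H₁ hH₀ (hA.bijOn_interIn_preimage hH₁ bij) ?_ ?_
      · rw [deletionPartition_inducedPartition hA hH₁]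
        exact ih' (hA.deletion hH₁)
      · rw [restrictionPartition_inducedPartition hA hπ hB₁ hH₀]
        exact ih'' (hA.restriction hH₁)
    · rw [← inducedPartition_deletionPartition_comap hA hπ hG]
      exact ih' (hA.symm.deletion hG).symm

section JointPartition

variable {K : Type*} [Field K] {U : Type*} [AddCommGroup U] [Module K U]
  {V : Type*} [AddCommGroup V] [Module K V] {W : Type*} [AddCommGroup W] [Module K W]
  {f : U →ₗ[K] V} {g : U →ₗ[K] W} {A : HyperplaneArrangement K U}
  {A₁ : HyperplaneArrangement K V} {A₂ : HyperplaneArrangement K W}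
  {π₁ : Set (Set (Submodule K V))} {π₂ : Set (Set (Submodule K W))} {B₁ : Set (Submodule K V)}
  {H₁ : Submodule K V}

/-- The partition of a joint pullback of `A₁` and `A₂` formed by the preimages of the blocks of a
partition `π₁` of `A₁` and of a partition `π₂` of `A₂`. -/
def jointPartition (f : U →ₗ[K] V) (g : U →ₗ[K] W) (π₁ : Set (Set (Submodule K V)))
    (π₂ : Set (Set (Submodule K W))) : Set (Set (Submodule K U)) :=
  (Submodule.comap f '' ·) '' π₁ ∪ (Submodule.comap g '' ·) '' π₂

theorem jointPartition_comm (f : U →ₗ[K] V) (g : U →ₗ[K] W) (π₁ : Set (Set (Submodule K V)))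
    (π₂ : Set (Set (Submodule K W))) : jointPartition f g π₁ π₂ = jointPartition g f π₂ π₁ :=
  Set.union_comm _ _

theorem IsJointPullback.image_comap_ne_image_comap (hA : IsJointPullback f g A A₁ A₂)
    (hB₁ : B₁ ⊆ A₁.hyperplanes) {C : Set (Submodule K W)} (hC : C.Nonempty) :
    Submodule.comap g '' C ≠ Submodule.comap f '' B₁ := by
  intro heq
  have hdisj := hA.disjoint_image_comap hB₁ C
  rw [← heq, disjoint_self] at hdisj
  exact (hC.image _).ne_empty hdisj

theorem IsPartition.jointPartition (hA : IsJointPullback f g A A₁ A₂) (hπ₁ : A₁.IsPartition π₁)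
    (hπ₂ : A₂.IsPartition π₂) : A.IsPartition (jointPartition f g π₁ π₂) where
  nonempty := by
    rintro _ (⟨B, hB, rfl⟩ | ⟨C, hC, rfl⟩)
    · exact (hπ₁.nonempty B hB).image _
    · exact (hπ₂.nonempty C hC).image _
  disjoint := by
    rintro _ (⟨B, hB, rfl⟩ | ⟨C, hC, rfl⟩) _ (⟨B', hB', rfl⟩ | ⟨C', hC', rfl⟩) hne
    · exact (Set.disjoint_image_iff hA.comap_injective).2
        (hπ₁.disjoint hB hB' fun heq => hne (heq ▸ rfl))
    · exact hA.disjoint_image_comap (hπ₁.subset hB) C'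
    · exact (hA.disjoint_image_comap (hπ₁.subset hB') C).symm
    · exact (Set.disjoint_image_iff hA.symm.comap_injective).2
        (hπ₂.disjoint hC hC' fun heq => hne (heq ▸ rfl))
  sUnion := by
    rw [hA.hyperplanes_eq, HyperplaneArrangement.jointPartition, Set.sUnion_union, ← hπ₁.sUnion,
      ← hπ₂.sUnion, Set.image_sUnion, Set.image_sUnion]

theorem blockSizes_jointPartition (hA : IsJointPullback f g A A₁ A₂) (hπ₁ : A₁.IsPartition π₁)
    (hπ₂ : A₂.IsPartition π₂) :
    blockSizes (jointPartition f g π₁ π₂) = blockSizes π₁ + blockSizes π₂ := by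
  have hdisj : Disjoint ((Submodule.comap f '' ·) '' π₁) ((Submodule.comap g '' ·) '' π₂) := by
    refine Set.disjoint_left.2 ?_
    rintro _ ⟨B, hB, rfl⟩ ⟨C, hC, heq⟩
    exact hA.image_comap_ne_image_comap (hπ₁.subset hB) (hπ₂.nonempty C hC) heq
  rw [jointPartition, blockSizes_union hdisj (hπ₁.finite.image _) (hπ₂.finite.image _),
    blockSizes_image hA.comap_injective.image_injective.injOn fun B _ =>
      Set.ncard_image_of_injective B hA.comap_injective,
    blockSizes_image hA.symm.comap_injective.image_injective.injOn fun C _ =>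
      Set.ncard_image_of_injective C hA.symm.comap_injective]

theorem deletionPartition_jointPartition (hA : IsJointPullback f g A A₁ A₂)
    (hπ₂ : A₂.IsPartition π₂) (hH₁ : H₁ ∈ A₁.hyperplanes) :
    A.deletionPartition (jointPartition f g π₁ π₂) (H₁.comap f) =
      jointPartition f g (A₁.deletionPartition π₁ H₁) π₂ := by
  have hA' := hA.deletion hH₁
  have hleft (B : Set (Submodule K V)) :
      Submodule.comap f '' B ∩ (A.deletion (H₁.comap f)).hyperplanes =
        Submodule.comap f '' (B ∩ (A₁.deletion H₁).hyperplanes) := by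
    rw [← hA'.preimage_hyperplanes, Set.image_inter_preimage]
  have hright (C : Set (Submodule K W)) (hC : C ∈ π₂) :
      Submodule.comap g '' C ∩ (A.deletion (H₁.comap f)).hyperplanes = Submodule.comap g '' C := by
    rw [← Set.image_inter_preimage, hA'.symm.preimage_hyperplanes,
      Set.inter_eq_left.2 (hπ₂.subset hC)]
  ext D
  constructor
  · rintro ⟨hne, _, ⟨B, hB, rfl⟩ | ⟨C, hC, rfl⟩, rfl⟩
    · rw [hleft] at hne ⊢
      exact Or.inl ⟨_, ⟨Set.image_nonempty.1 hne, B, hB, rfl⟩, rfl⟩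
    · exact Or.inr ⟨C, hC, (hright C hC).symm⟩
  · rintro (⟨_, ⟨hne, B, hB, rfl⟩, rfl⟩ | ⟨C, hC, rfl⟩)
    · exact ⟨hne.image _, _, Or.inl ⟨B, hB, rfl⟩, (hleft B).symm⟩
    · exact ⟨(hπ₂.nonempty C hC).image _, _, Or.inr ⟨C, hC, rfl⟩, (hright C hC).symm⟩

theorem jointPartition_sdiff_singleton (hA : IsJointPullback f g A A₁ A₂)
    (hB₁ : B₁ ⊆ A₁.hyperplanes) (hπ₂ : A₂.IsPartition π₂) :
    jointPartition f g π₁ π₂ \ {Submodule.comap f '' B₁} =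
      jointPartition f g (π₁ \ {B₁}) π₂ := by
  have hnotMem : Submodule.comap f '' B₁ ∉ (Submodule.comap g '' ·) '' π₂ := fun ⟨C, hC, heq⟩ =>
    hA.image_comap_ne_image_comap hB₁ (hπ₂.nonempty C hC) heq
  rw [jointPartition, Set.union_sdiff_distrib, Set.sdiff_singleton_eq_self hnotMem, jointPartition,
    Set.image_sdiff hA.comap_injective.image_injective, Set.image_singleton]

theorem restrictionPartition_jointPartition (hA : IsJointPullback f g A A₁ A₂)
    (hB₁ : B₁ ⊆ A₁.hyperplanes) (hπ₂ : A₂.IsPartition π₂) (H₁ : Submodule K V) :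
    restrictionPartition (jointPartition f g π₁ π₂) (Submodule.comap f '' B₁) (H₁.comap f) =
      jointPartition (comapRestrict f H₁) (g ∘ₗ (H₁.comap f).subtype)
        (restrictionPartition π₁ B₁ H₁) π₂ := by
  rw [restrictionPartition, jointPartition_sdiff_singleton hA hB₁ hπ₂]
  simp only [jointPartition, restrictionPartition, Set.image_union, Set.image_image]
  rfl

end JointPartition

section Product

variable {K : Type u} [Field K]

theorem IsInductiveFactorization.jointPartition_of_left {U : Type v} [AddCommGroup U] [Module K U]
    {V : Type*} [AddCommGroup V] [Module K V] {W : Type*} [AddCommGroup W] [Module K W]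
    {f : U →ₗ[K] V} {g : U →ₗ[K] W} {A : HyperplaneArrangement K U}
    {A₁ : HyperplaneArrangement K V} {A₂ : HyperplaneArrangement K W}
    {π₁ : Set (Set (Submodule K V))} {π₂ : Set (Set (Submodule K W))}
    {B₁ : Set (Submodule K V)} {H₁ : Submodule K V}
    (hA : IsJointPullback f g A A₁ A₂) (hπ₁ : A₁.IsPartition π₁) (hπ₂ : A₂.IsPartition π₂)
    (hB₁ : B₁ ∈ π₁) (hH₁ : H₁ ∈ B₁)
    (bij : Set.BijOn (interIn H₁) (A₁.hyperplanes \ B₁) (A₁.restriction H₁).hyperplanes)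
    (hdel : IsInductiveFactorization (A.deletion (H₁.comap f))
      (jointPartition f g (A₁.deletionPartition π₁ H₁) π₂))
    (hres : IsInductiveFactorization (A.restriction (H₁.comap f))
      (jointPartition (comapRestrict f H₁) (g ∘ₗ (H₁.comap f).subtype)
        (restrictionPartition π₁ B₁ H₁) π₂)) :
    IsInductiveFactorization A (jointPartition f g π₁ π₂) := by
  have hB₁A := hπ₁.subset hB₁
  rw [← deletionPartition_jointPartition hA hπ₂ (hB₁A hH₁)] at hdel
  rw [← restrictionPartition_jointPartition hA hB₁A hπ₂ H₁] at hres
  exact .addition A _ (hπ₁.jointPartition hA hπ₂) _ (Or.inl ⟨B₁, hB₁, rfl⟩) _ ⟨H₁, hH₁, rfl⟩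
    (hA.bijOn_interIn_comap hB₁A hH₁ bij) hdel hres

theorem isPartition_empty {V : Type*} [AddCommGroup V] [Module K V] :
    (empty K V).IsPartition ∅ where
  nonempty _ h := h.elim
  disjoint _ h := h.elim
  sUnion := Set.sUnion_empty

theorem IsInductiveFactorization.isPartition {V : Type*} [AddCommGroup V] [Module K V]
    {A : HyperplaneArrangement K V} {π : Set (Set (Submodule K V))}
    (h : IsInductiveFactorization A π) : A.IsPartition π := by
  cases h with
  | empty => exact isPartition_empty
  | addition _ _ hπ => exact hπ

theorem IsInductiveFactorization.jointPartition_empty {V : Type v} [AddCommGroup V] [Module K V]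
    {A₁ : HyperplaneArrangement K V} {π₁ : Set (Set (Submodule K V))}
    (h₁ : IsInductiveFactorization A₁ π₁) {W : Type*} [AddCommGroup W] [Module K W] :
    ∀ {U : Type w} [AddCommGroup U] [Module K U] {f : U →ₗ[K] V} {g : U →ₗ[K] W}
      {A : HyperplaneArrangement K U}, IsJointPullback f g A A₁ (HyperplaneArrangement.empty K W) →
      IsInductiveFactorization A (jointPartition f g π₁ ∅) := by
  induction h₁ with
  | empty V =>
    intro U _ _ f g A hA
    refine isInductiveFactorization_of_eq_empty (hA.hyperplanes_eq.trans ?_) ?_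
    · simp only [HyperplaneArrangement.empty, Set.image_empty, Set.union_empty]
    · simp only [jointPartition, Set.image_empty, Set.union_empty]
  | @addition V _ _ A₁ π₁ hπ₁ B₁ hB₁ H₁ hH₁ bij _ _ ih' ih'' =>
    intro U _ _ f g A hA
    have hH₁A := hπ₁.subset hB₁ hH₁
    exact .jointPartition_of_left hA hπ₁ isPartition_empty hB₁ hH₁ bij (ih' (hA.deletion hH₁A))
      (ih'' (hA.restriction hH₁A))

theorem IsInductiveFactorization.jointPartition {V : Type v} [AddCommGroup V] [Module K V]
    {A₁ : HyperplaneArrangement K V} {π₁ : Set (Set (Submodule K V))}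
    (h₁ : IsInductiveFactorization A₁ π₁) {W : Type*} [AddCommGroup W] [Module K W]
    {A₂ : HyperplaneArrangement K W} {π₂ : Set (Set (Submodule K W))}
    (h₂ : IsInductiveFactorization A₂ π₂) :
    ∀ {U : Type w} [AddCommGroup U] [Module K U] {f : U →ₗ[K] V} {g : U →ₗ[K] W}
      {A : HyperplaneArrangement K U}, IsJointPullback f g A A₁ A₂ →
      IsInductiveFactorization A (jointPartition f g π₁ π₂) := by
  induction h₁ with
  | empty V =>
    intro U _ _ f g A hA
    rw [jointPartition_comm]
    exact h₂.jointPartition_empty hA.symm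
  | @addition V _ _ A₁ π₁ hπ₁ B₁ hB₁ H₁ hH₁ bij _ _ ih' ih'' =>
    intro U _ _ f g A hA
    have hH₁A := hπ₁.subset hB₁ hH₁
    exact .jointPartition_of_left hA hπ₁ h₂.isPartition hB₁ hH₁ bij (ih' (hA.deletion hH₁A))
      (ih'' (hA.restriction hH₁A))

variable {V : Type*} [AddCommGroup V] [Module K V] {W : Type*} [AddCommGroup W] [Module K W]
  {A₁ : HyperplaneArrangement K V} {A₂ : HyperplaneArrangement K W}

theorem isInductivelyFactored_prod_iff :
    (A₁.prod A₂).IsInductivelyFactored ↔ A₁.IsInductivelyFactored ∧ A₂.IsInductivelyFactored := by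
  have hA := isJointPullback_prod A₁ A₂
  constructor
  · rintro ⟨π, hπ⟩
    exact ⟨⟨_, hπ.inducedPartition hA⟩, ⟨_, hπ.inducedPartition hA.symm⟩⟩
  · rintro ⟨⟨π₁, hπ₁⟩, ⟨π₂, hπ₂⟩⟩
    exact ⟨_, hπ₁.jointPartition hπ₂ hA⟩

theorem IsInductivelyFactored.exists_isFreeWithExponents_prod [FiniteDimensional K V]
    [FiniteDimensional K W] (h₁ : A₁.IsInductivelyFactored) (h₂ : A₂.IsInductivelyFactored) :
    ∃ E₁ E₂ : Multiset ℕ, A₁.IsFreeWithExponents E₁ ∧ A₂.IsFreeWithExponents E₂ ∧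
      (A₁.prod A₂).IsFreeWithExponents (E₁ + E₂) := by
  have hA := isJointPullback_prod A₁ A₂
  obtain ⟨π₁, hπ₁⟩ := h₁
  obtain ⟨π₂, hπ₂⟩ := h₂
  obtain ⟨E₁, hE₁, hcard₁, hblocks₁⟩ := hπ₁.exists_isFreeWithExponents
  obtain ⟨E₂, hE₂, hcard₂, hblocks₂⟩ := hπ₂.exists_isFreeWithExponents
  obtain ⟨E, hE, hcard, hblocks⟩ := (hπ₁.jointPartition hπ₂ hA).exists_isFreeWithExponents
  have hsum : E = E₁ + E₂ := by
    refine eq_of_card_eq_of_filter_ne_zero_eq ?_ ?_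
    · rw [hcard, Multiset.card_add, hcard₁, hcard₂, Module.finrank_prod]
    · rw [hblocks, Multiset.filter_add, hblocks₁, hblocks₂,
        blockSizes_jointPartition hA hπ₁.isPartition hπ₂.isPartition]
  exact ⟨E₁, E₂, hE₁, hE₂, hsum ▸ hE⟩

end Product

end HyperplaneArrangement

open HyperplaneArrangement

theorem mainTheorem7 {K : Type*} [Field K]
    {V₁ : Type*} [AddCommGroup V₁] [Module K V₁] [FiniteDimensional K V₁]
    {V₂ : Type*} [AddCommGroup V₂] [Module K V₂] [FiniteDimensional K V₂]
    (A₁ : HyperplaneArrangement K V₁) (A₂ : HyperplaneArrangement K V₂) :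
    ((A₁.prod A₂).IsInductivelyFactored ↔
      A₁.IsInductivelyFactored ∧ A₂.IsInductivelyFactored) ∧
    ((A₁.prod A₂).IsInductivelyFactored →
      (∃ E₁ : Multiset ℕ, A₁.IsFreeWithExponents E₁) ∧
      (∃ E₂ : Multiset ℕ, A₂.IsFreeWithExponents E₂) ∧
      ∀ E₁ E₂ : Multiset ℕ, A₁.IsFreeWithExponents E₁ → A₂.IsFreeWithExponents E₂ →
        ∀ E : Multiset ℕ, (A₁.prod A₂).IsFreeWithExponents E ↔ E = E₁ + E₂) := by
  refine ⟨isInductivelyFactored_prod_iff, fun h => ?_⟩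
  obtain ⟨h₁, h₂⟩ := isInductivelyFactored_prod_iff.1 h
  obtain ⟨F₁, F₂, hF₁, hF₂, hF⟩ := h₁.exists_isFreeWithExponents_prod h₂
  refine ⟨⟨F₁, hF₁⟩, ⟨F₂, hF₂⟩, fun E₁ E₂ hE₁ hE₂ E => ?_⟩
  rw [hE₁.unique hF₁, hE₂.unique hF₂]
  exact ⟨fun hE => hE.unique hF, fun hE => hE ▸ hF⟩
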